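/- Let $\mathcal{T}$ be the infinite metric tree with all edges of length one in which every vertex has degree three, and let $\mathcal{T}_0$ be the infinite rooted metric tree with all edges of length one in which the root has degree one and every other vertex has degree three. Let $\mathcal{G}=\mathcal{T}$ or $\mathcal{G}=\mathcal{T}_0$, and let $p\in(2,6)$. Let $H^1(\mathcal{G})$ be the space of real continuous functions $u$ on $\mathcal{G}$ that are absolutely continuous along every edge and satisfy $u,u'\in L^2(\mathcal{G})$. For $u\in H^1(\mathcal{G})$ put $$E(u,\mathcal{G})=\frac12\int_{\mathcal{G}}|u'|^2\,dx-\frac1p\int_{\mathcal{G}}|u|^p\,dx ,$$ and for $\mu\ge 0$ put $$H^1_\mu(\mathcal{G})=\Big\{u\in H^1(\mathcal{G}):\int_{\mathcal{G}}|u|^2\,dx=\mu\Big\},\qquad \mathcal{E}_{\mathcal{G}}(\mu)=\inf_{u\in H^1_\mu(\mathcal{G})}E(u,\mathcal{G}).$$ A ground state of mass $\mu$ is a function $u\in H^1_\mu(\mathcal{G})$ with $E(u,\mathcal{G})=\mathcal{E}_{\mathcal{G}}(\mu)$. Let $$\lambda_1=\inf_{u\in H^1(\mathcal{T}),\,u\not\equiv0}\frac{\int_{\mathcal{T}}|u'|^2\,dx}{\int_{\mathcal{T}}|u|^2\,dx}=\inf_{u\in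 H^1(\mathcal{T}_0),\,u\not\equiv0}\frac{\int_{\mathcal{T}_0}|u'|^2\,dx}{\int_{\mathcal{T}_0}|u|^2\,dx}$$ (the two infima coincide and are positive). Then $\mathcal{E}_{\mathcal{G}}(\mu)$ is finite for every $\mu\ge0$, the maximum $$\mu^*_{\mathcal{G}}=\max\Big\{\mu\ge0:\mathcal{E}_{\mathcal{G}}(\mu)=\tfrac12\lambda_1\mu\Big\}$$ exists, $\mathcal{E}_{\mathcal{G}}(\mu)=\frac12\lambda_1\mu$ for $\mu\in[0,\mu^*_{\mathcal{G}}]$, and $\mathcal{E}_{\mathcal{G}}(\mu)<\frac12\lambda_1\mu$ for $\mu>\mu^*_{\mathcal{G}}$. Ground states of mass $\mu$ exist for every $\mu>\mu^*_{\mathcal{G}}$ and do not exist for any $\mu\in(0,\mu^*_{\mathcal{G}})$. Moreover: (i) if $p\in[4,6)$, then $\mu^*_{\mathcal{G}}>0$; (ii) if $p\in(4,6)$, then a ground state of mass $\mu^*_{\mathcal{G}}$ also exists. -/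

import Mathlib

open MeasureTheory Set

/-- A metric graph with countably many edges, all of length one. Every edge `e` is a copy of the
interval `[0, 1]`, whose endpoint `0` is glued at the vertex `src e` and whose endpoint `1` is
glued at the vertex `tgt e`. -/
structure UnitMetricGraph where
  Vertex : Type
  Edge : Type
  countable_edge : Countable Edge
  src : Edge → Vertex
  tgt : Edge → Vertex

namespace UnitMetricGraph

/-- Every set of edges is measurable (the edges carry the counting measure). -/
instance instMeasurableSpaceEdge (G : UnitMetricGraph) : MeasurableSpace G.Edge := ⊤

instance instCountableEdge (G : UnitMetricGraph) : Countable G.Edge := G.countable_edge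

/-- The length measure `dx` on the graph: Lebesgue measure on each edge `[0, 1]`, summed over the
edges. The pair `(e, x)` stands for the point with coordinate `x` on the edge `e`. -/
noncomputable def lengthMeasure (G : UnitMetricGraph) : Measure (G.Edge × ℝ) :=
  (Measure.count : Measure G.Edge).prod (volume.restrict (Icc (0 : ℝ) 1))

/-- `u ∈ H¹(G)` for a real function `u` on the graph (`u e x` is the value at the point with
coordinate `x ∈ [0, 1]` of the edge `e`; the values for `x ∉ [0, 1]` are irrelevant):
`u` is continuous on the graph, absolutely continuous along each edge,
and both `u` and `u'` are square integrable on the graph. -/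
structure MemH1 (G : UnitMetricGraph) (u : G.Edge → ℝ → ℝ) : Prop where
  /-- the values at the ends of the edges agree at the vertices -/
  continuous_vertex : ∃ φ : G.Vertex → ℝ, ∀ e, u e 0 = φ (G.src e) ∧ u e 1 = φ (G.tgt e)
  absolutelyContinuous_edge : ∀ e, AbsolutelyContinuousOnInterval (u e) 0 1
  memLp : MemLp (fun z : G.Edge × ℝ => u z.1 z.2) 2 G.lengthMeasure
  memLp_deriv : MemLp (fun z : G.Edge × ℝ => deriv (u z.1) z.2) 2 G.lengthMeasure

/-- The mass `∫_G |u|² dx`. -/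
noncomputable def mass (G : UnitMetricGraph) (u : G.Edge → ℝ → ℝ) : ℝ :=
  ∫ z, |u z.1 z.2| ^ 2 ∂G.lengthMeasure

/-- The Dirichlet integral `∫_G |u'|² dx`. -/
noncomputable def kinetic (G : UnitMetricGraph) (u : G.Edge → ℝ → ℝ) : ℝ :=
  ∫ z, |deriv (u z.1) z.2| ^ 2 ∂G.lengthMeasure

/-- The NLS energy `E(u, G) = (1/2) ∫_G |u'|² dx - (1/p) ∫_G |u|^p dx`. -/
noncomputable def energy (G : UnitMetricGraph) (p : ℝ) (u : G.Edge → ℝ → ℝ) : ℝ :=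
  1 / 2 * G.kinetic u - 1 / p * ∫ z, |u z.1 z.2| ^ p ∂G.lengthMeasure

/-- The class `H¹_μ(G)` of `H¹` functions of mass `μ`. -/
def H1mass (G : UnitMetricGraph) (μ : ℝ) : Set (G.Edge → ℝ → ℝ) :=
  {u | G.MemH1 u ∧ G.mass u = μ}

/-- The ground-state energy level `inf {E(u, G) : u ∈ H¹_μ(G)}`. -/
noncomputable def level (G : UnitMetricGraph) (p μ : ℝ) : ℝ :=
  sInf (G.energy p '' G.H1mass μ)

/-- `u` is a ground state of mass `μ`: it belongs to `H¹_μ(G)` and achieves the level. -/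
def IsGroundState (G : UnitMetricGraph) (p μ : ℝ) (u : G.Edge → ℝ → ℝ) : Prop :=
  u ∈ G.H1mass μ ∧ G.energy p u = G.level p μ

/-- The infimum of the Rayleigh quotient `∫_G |u'|² dx / ∫_G |u|² dx` over `u ∈ H¹(G)`, `u ≢ 0`. -/
noncomputable def rayleighInf (G : UnitMetricGraph) : ℝ :=
  sInf ((fun u => G.kinetic u / G.mass u) '' {u | G.MemH1 u ∧ G.mass u ≠ 0})

end UnitMetricGraph

/-- The tree with unit edges obtained by joining `k` infinite binary branches at their roots. The
edges of the `i`-th branch are labelled by finite binary words (most recent letter first): the edge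
`(i, [])` starts at the root `none`, the edge `(i, w)` ends at the vertex `some (i, w)`, and the two
edges `(i, false :: w)` and `(i, true :: w)` start at that vertex. The root has degree `k`,
every other vertex has degree three. -/
def joinedBinaryBranches (k : ℕ) : UnitMetricGraph where
  Vertex := Option (Fin k × List Bool)
  Edge := Fin k × List Bool
  countable_edge := inferInstance
  src := fun e => match e with
    | (_, []) => none
    | (i, _ :: w) => some (i, w)
  tgt := fun e => some e

/-- The rooted binary tree `T₀`: the root has degree one, every other vertex has degree three. -/
def rootedBinaryTree : UnitMetricGraph := joinedBinaryBranches 1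

/-- The unrooted binary tree `T`: every vertex has degree three. -/
def binaryTree : UnitMetricGraph := joinedBinaryBranches 3

/-- The best Poincaré constant `λ₁`, defined on the unrooted tree. -/
noncomputable def lambda1 : ℝ := binaryTree.rayleighInf

/-- The masses `μ ≥ 0` at which the energy level equals `λ₁ μ / 2`. -/
def linearMasses (G : UnitMetricGraph) (p : ℝ) : Set ℝ :=
  {μ | 0 ≤ μ ∧ G.level p μ = 1 / 2 * lambda1 * μ}

/-- The critical mass: the largest mass at which the energy level equals `λ₁ μ / 2`
(written as a supremum; that it is a maximum is a claim). -/
noncomputable def criticalMass (G : UnitMetricGraph) (p : ℝ) : ℝ :=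
  sSup (linearMasses G p)

/-!
The energy level, the critical mass and ground states are treated on an arbitrary graph for which
`λ₁` is a positive spectral gap, `K(u) ≥ λ₁ M(u)` with `K` the Dirichlet integral and `M` the mass,
and the two trees enter through three facts.

*The shape of the level.* Raising the amplitude of a function with `p > 2` lowers its energy per
unit mass (`MemH1.exists_scale`). So `level μ / μ` is nonincreasing, it is at most `λ₁ / 2` because
the nonlinear term has a sign, and it tends to `-∞`; the masses with linear level therefore form a
compact interval `[0, μ*]` (`SpectralGap.isGreatest_sSup`). A ground state of mass below `μ*` could
be scaled up to beat the linear level at `μ*`. The level is finite since for `p < 6` the one-edge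
Gagliardo–Nirenberg inequality lets the Dirichlet integral absorb the nonlinear term.

*Compactness.* `exists_energy_le_of_not_vanishing`: almost minimizers which do not vanish on a fixed
edge converge, uniformly on edges, to a nonzero limit, and mass and energy split between limit and
remainder. If the limit had too small a mass, it would have strictly more than its share of the
energy, and the remainder has at least its share. Limits are taken along an ultrafilter, edge by
edge, so that no subsequences have to be extracted. Almost minimizers do not vanish in sup norm when
the level is strictly below the linear one, and, if `p > 4`, also when masses decrease to `μ*`.

*The trees.* Functions are cut into branches, and a branch is its root edge with two branches
grafted on it. The Poincaré inequality is an `ℓ²` estimate for the values at the vertices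
(`BranchH1.mass_le_kin`). Applied to the function that is constant on a new root edge and continues
with two copies of `f`, the inequality with the best constant yields
`λ₁ f(root)² / 2 ≤ K(f) - λ₁ M(f)` (`BranchH1.root_sq_le`), whence the deficit `K - λ₁ M` controls
the square of the sup norm. For `p ≥ 4` this makes the energy at small mass at least `λ₁ M / 2`, so
`μ* > 0`.

On the unrooted tree any edge can be moved to the root, which gives ground states directly. On the
rooted tree almost minimizers either keep a nonzero value at the root, and compactness applies, or
can be extended by small tents to the unrooted tree. In that case there is a function on the
unrooted tree with the right mass and energy at most the level of the rooted one; moving the root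
far away, cutting off two branches of tiny mass (which carry at least their share of the energy) and
rescaling brings it back to the rooted tree.
-/

/-! ### Sobolev functions on one edge -/

/-- `f ∈ H¹(0, 1)`: `f` is absolutely continuous on `[0, 1]` with square integrable derivative. -/
structure EdgeH1 (f : ℝ → ℝ) : Prop where
  ac : AbsolutelyContinuousOnInterval f 0 1
  memLp_deriv : MemLp (deriv f) 2 (volume.restrict (Icc (0 : ℝ) 1))

/-- The mass `∫ |f|²` carried by one edge. -/
noncomputable def edgeMass (f : ℝ → ℝ) : ℝ := ∫ x in Icc (0 : ℝ) 1, |f x| ^ 2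

/-- The Dirichlet integral `∫ |f'|²` of one edge. -/
noncomputable def edgeKin (f : ℝ → ℝ) : ℝ := ∫ x in Icc (0 : ℝ) 1, |deriv f x| ^ 2

/-- The integral `∫ |f|^p` over one edge. -/
noncomputable def edgePow (p : ℝ) (f : ℝ → ℝ) : ℝ := ∫ x in Icc (0 : ℝ) 1, |f x| ^ p

lemma edgeMass_nonneg (f : ℝ → ℝ) : 0 ≤ edgeMass f := integral_nonneg fun _ => by positivity

lemma edgeKin_nonneg (f : ℝ → ℝ) : 0 ≤ edgeKin f := integral_nonneg fun _ => by positivity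

lemma edgePow_nonneg (p : ℝ) (f : ℝ → ℝ) : 0 ≤ edgePow p f :=
  integral_nonneg fun _ => by positivity

lemma AbsolutelyContinuousOnInterval.congr_uIcc {f g : ℝ → ℝ} {a b : ℝ}
    (hf : AbsolutelyContinuousOnInterval f a b) (h : EqOn f g (uIcc a b)) :
    AbsolutelyContinuousOnInterval g a b := by
  unfold AbsolutelyContinuousOnInterval at hf ⊢
  refine hf.congr' ?_
  have : AbsolutelyContinuousOnInterval.disjWithin a b ∈
      AbsolutelyContinuousOnInterval.totalLengthFilter ⊓
        Filter.principal (AbsolutelyContinuousOnInterval.disjWithin a b) :=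
    Filter.mem_inf_of_right (Filter.mem_principal_self _)
  filter_upwards [this] with E hE
  refine Finset.sum_congr rfl fun i hi => ?_
  rw [h (hE.1 i hi).1, h (hE.1 i hi).2]

lemma setIntegral_unitInterval (F : ℝ → ℝ) :
    ∫ x in Icc (0 : ℝ) 1, F x = ∫ x in (0 : ℝ)..1, F x := by
  rw [intervalIntegral.integral_of_le zero_le_one, integral_Icc_eq_integral_Ioc]

namespace EdgeH1

variable {f g : ℝ → ℝ}

lemma continuousOn (hf : EdgeH1 f) : ContinuousOn f (Icc 0 1) := by
  simpa using hf.ac.continuousOn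

lemma ae_differentiableAt (hf : EdgeH1 f) :
    ∀ᵐ x ∂(volume.restrict (Icc (0 : ℝ) 1)), DifferentiableAt ℝ f x := by
  rw [ae_restrict_iff' measurableSet_Icc]
  filter_upwards [hf.ac.ae_differentiableAt] with x hx h
  exact hx (by simpa using h)

lemma bounded (hf : EdgeH1 f) : ∃ C, ∀ x ∈ Icc (0 : ℝ) 1, |f x| ≤ C := by
  obtain ⟨C, hC⟩ := hf.ac.exists_bound
  exact ⟨C, fun x hx => hC x (by simpa using hx)⟩

lemma memLp (hf : EdgeH1 f) (q : ENNReal) : MemLp f q (volume.restrict (Icc (0 : ℝ) 1)) := by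
  obtain ⟨C, hC⟩ := hf.bounded
  refine MemLp.of_bound (hf.continuousOn.aestronglyMeasurable measurableSet_Icc) C ?_
  filter_upwards [ae_restrict_mem measurableSet_Icc] with x hx using hC x hx

lemma integrable_sq (hf : EdgeH1 f) :
    Integrable (fun x => |f x| ^ 2) (volume.restrict (Icc (0 : ℝ) 1)) := by
  simpa using (hf.memLp 2).integrable_norm_pow (by norm_num)

lemma integrable_deriv_sq (hf : EdgeH1 f) :
    Integrable (fun x => |deriv f x| ^ 2) (volume.restrict (Icc (0 : ℝ) 1)) := by
  simpa using hf.memLp_deriv.integrable_norm_pow (by norm_num)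

lemma integrable_rpow (hf : EdgeH1 f) {p : ℝ} (hp : 0 ≤ p) :
    Integrable (fun x => |f x| ^ p) (volume.restrict (Icc (0 : ℝ) 1)) :=
  (hf.continuousOn.abs.rpow_const fun _ _ => Or.inr hp).integrableOn_Icc

lemma integrable_mul (hf : EdgeH1 f) (hg : EdgeH1 g) :
    Integrable (fun x => f x * g x) (volume.restrict (Icc (0 : ℝ) 1)) :=
  (hf.continuousOn.mul hg.continuousOn).integrableOn_Icc

lemma integrable_deriv_mul (hf : EdgeH1 f) (hg : EdgeH1 g) :
    Integrable (fun x => deriv f x * deriv g x) (volume.restrict (Icc (0 : ℝ) 1)) :=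
  hf.memLp_deriv.integrable_mul hg.memLp_deriv

lemma sub_eq_integral (hf : EdgeH1 f) {x y : ℝ} (hx : x ∈ Icc (0 : ℝ) 1)
    (hy : y ∈ Icc (0 : ℝ) 1) : f y - f x = ∫ t in x..y, deriv f t := by
  rw [AbsolutelyContinuousOnInterval.integral_deriv_eq_sub]
  exact hf.ac.mono (uIcc_subset_uIcc (by simpa using hx) (by simpa using hy))

/-- The Hölder bound `|f(y) - f(x)|² ≤ |y - x| ∫ |f'|²`. -/
lemma sq_sub_le (hf : EdgeH1 f) {x y : ℝ} (hx : x ∈ Icc (0 : ℝ) 1) (hy : y ∈ Icc (0 : ℝ) 1) :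
    (f y - f x) ^ 2 ≤ |y - x| * edgeKin f := by
  wlog hxy : x ≤ y generalizing x y
  · rw [abs_sub_comm, ← neg_sq, neg_sub]
    exact this hy hx (le_of_not_ge hxy)
  rw [hf.sub_eq_integral hx hy, intervalIntegral.integral_of_le hxy, abs_of_nonneg (by linarith)]
  have hsub : Ioc x y ⊆ Icc 0 1 := fun t ht => ⟨hx.1.trans ht.1.le, ht.2.trans hy.2⟩
  have hm : MemLp (deriv f) 2 (volume.restrict (Ioc x y)) :=
    hf.memLp_deriv.mono_measure (Measure.restrict_mono hsub le_rfl)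
  set I := ∫ t in Ioc x y, deriv f t with hI
  have h1 : Integrable (deriv f) (volume.restrict (Ioc x y)) := hm.integrable (by norm_num)
  have h2 : Integrable (fun t => |deriv f t| ^ 2) (volume.restrict (Ioc x y)) := by
    simpa using hm.integrable_norm_pow (by norm_num)
  -- the variance of `f'` on `(x, y)` is nonnegative
  have h3 : 0 ≤ ∫ t in Ioc x y, ((y - x) * deriv f t - I) ^ 2 :=
    integral_nonneg fun _ => sq_nonneg _
  have h4 : ∫ t in Ioc x y, ((y - x) * deriv f t - I) ^ 2
      = (y - x) ^ 2 * (∫ t in Ioc x y, |deriv f t| ^ 2) - 2 * (y - x) * I * I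
        + (y - x) * I ^ 2 := by
    have : ∀ t, ((y - x) * deriv f t - I) ^ 2
        = ((y - x) ^ 2 * |deriv f t| ^ 2 - 2 * (y - x) * I * deriv f t) + I ^ 2 := fun t => by
      rw [sq_abs]; ring
    simp_rw [this]
    have h5 : Integrable (fun t => (y - x) ^ 2 * |deriv f t| ^ 2 - 2 * (y - x) * I * deriv f t)
        (volume.restrict (Ioc x y)) := (h2.const_mul _).sub (h1.const_mul _)
    rw [integral_add h5 (integrable_const _),
      integral_sub (h2.const_mul _) (h1.const_mul _), integral_const_mul, integral_const_mul]
    simp [hxy, hI]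
  have h5 : ∫ t in Ioc x y, |deriv f t| ^ 2 ≤ edgeKin f :=
    setIntegral_mono_set hf.integrable_deriv_sq (ae_of_all _ fun _ => by positivity)
      hsub.eventuallyLE
  rcases hxy.eq_or_lt with rfl | hlt
  · simp [hI]
  have h6 : 0 < y - x := by linarith
  rw [h4] at h3
  have h7 : I ^ 2 ≤ (y - x) * ∫ t in Ioc x y, |deriv f t| ^ 2 := by
    by_contra! hc
    nlinarith
  exact h7.trans (mul_le_mul_of_nonneg_left h5 h6.le)

/-- The one-edge Gagliardo–Nirenberg bound for the sup norm. -/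
lemma sq_le (hf : EdgeH1 f) {x : ℝ} (hx : x ∈ Icc (0 : ℝ) 1) :
    f x ^ 2 ≤ edgeMass f + 2 * √(edgeMass f * edgeKin f) := by
  -- compare `f x ^ 2` with the value of `f ^ 2` at a minimum point
  obtain ⟨y, hy, hmin⟩ := isCompact_Icc.exists_isMinOn (nonempty_Icc.2 zero_le_one)
    (hf.continuousOn.pow 2)
  have h1 : f y ^ 2 ≤ edgeMass f := by
    have : ∫ _ in Icc (0 : ℝ) 1, f y ^ 2 ≤ edgeMass f := by
      refine integral_mono_ae (integrable_const _) hf.integrable_sq ?_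
      filter_upwards [ae_restrict_mem measurableSet_Icc] with t ht
      rw [sq_abs]
      exact hmin ht
    simpa using this
  have hsub : uIcc y x ⊆ uIcc 0 1 := uIcc_subset_uIcc (by simpa using hy) (by simpa using hx)
  have h2 := (hf.ac.mono hsub).integral_deriv_mul_eq_sub (hf.ac.mono hsub)
  have hcs : ∫ t in Icc (0 : ℝ) 1, |f t| * |deriv f t| ≤ √(edgeMass f * edgeKin f) := by
    have := integral_mul_norm_le_Lp_mul_Lq (μ := volume.restrict (Icc (0 : ℝ) 1))
      (f := f) (g := deriv f) (p := 2) (q := 2) ⟨by norm_num, by norm_num, by norm_num⟩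
      (by simpa using hf.memLp 2) (by simpa using hf.memLp_deriv)
    simp only [Real.norm_eq_abs] at this
    rw [← Real.sqrt_eq_rpow, ← Real.sqrt_eq_rpow, ← Real.sqrt_mul] at this
    · simpa [edgeMass, edgeKin] using this
    · exact integral_nonneg fun _ => by positivity
  have h3 : |∫ t in y..x, deriv f t * f t + f t * deriv f t|
      ≤ ∫ t in Icc (0 : ℝ) 1, 2 * (|f t| * |deriv f t|) := by
    refine (intervalIntegral.norm_integral_le_integral_norm_uIoc (μ := volume)
      (f := fun t => deriv f t * f t + f t * deriv f t)).trans ?_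
    refine (setIntegral_mono_set (t := Icc (0 : ℝ) 1) ?_
      (ae_of_all _ fun _ => norm_nonneg _) ?_).trans_eq ?_
    · exact (((hf.memLp_deriv).integrable_mul (hf.memLp 2)).add
        ((hf.memLp 2).integrable_mul (hf.memLp_deriv))).norm
    · refine LE.le.eventuallyLE ?_
      exact uIoc_subset_uIcc.trans (by simpa using hsub)
    · refine integral_congr_ae (ae_of_all _ fun t => ?_)
      simp only [Real.norm_eq_abs]
      rw [mul_comm (deriv f t), ← two_mul, abs_mul, abs_mul, abs_two]
  rw [integral_const_mul] at h3
  have h4 := le_abs_self (∫ t in y..x, deriv f t * f t + f t * deriv f t)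
  rw [h2] at h3 h4
  nlinarith

/-- A primitive of an `L²` function is in `H¹(0, 1)`, with the expected derivative. -/
lemma of_integral {g : ℝ → ℝ} (hg : MemLp g 2 (volume.restrict (Icc (0 : ℝ) 1))) {c : ℝ}
    (hf : ∀ x ∈ Icc (0 : ℝ) 1, f x = c + ∫ t in (0 : ℝ)..x, g t) :
    EdgeH1 f ∧ deriv f =ᵐ[volume.restrict (Icc (0 : ℝ) 1)] g := by
  have hint : IntervalIntegrable g volume 0 1 := by
    rw [intervalIntegrable_iff_integrableOn_Icc_of_le zero_le_one]
    exact hg.integrable (by norm_num)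
  have hac : AbsolutelyContinuousOnInterval (fun x => c + ∫ t in (0 : ℝ)..x, g t) 0 1 :=
    (ContDiffOn.absolutelyContinuousOnInterval (contDiffOn_const (c := c))).fun_add
      (hint.absolutelyContinuousOnInterval_intervalIntegral (c := 0) (by simp))
  have hd : deriv f =ᵐ[volume.restrict (Icc (0 : ℝ) 1)] g := by
    rw [← restrict_Ioo_eq_restrict_Icc, Filter.EventuallyEq, ae_restrict_iff' measurableSet_Ioo]
    filter_upwards [hint.ae_hasDerivAt_integral] with x hx hx'
    have h1 := hx (by simpa using Ioo_subset_Icc_self hx') 0 (by simp)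
    have h2 : f =ᶠ[nhds x] fun y => c + ∫ t in (0 : ℝ)..y, g t := by
      filter_upwards [Ioo_mem_nhds hx'.1 hx'.2] with y hy using hf y (Ioo_subset_Icc_self hy)
    rw [h2.deriv_eq]
    simpa using (h1.const_add c).deriv
  refine ⟨⟨hac.congr_uIcc fun x hx => (hf x (by simpa using hx)).symm, ?_⟩, hd⟩
  exact (memLp_congr_ae hd).2 hg

protected lemma const (c : ℝ) : EdgeH1 fun _ => c :=
  ⟨ContDiffOn.absolutelyContinuousOnInterval contDiffOn_const, by simp⟩

lemma ae_deriv_sub (hf : EdgeH1 f) (hg : EdgeH1 g) :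
    deriv (fun x => f x - g x) =ᵐ[volume.restrict (Icc (0 : ℝ) 1)]
      fun x => deriv f x - deriv g x := by
  filter_upwards [hf.ae_differentiableAt, hg.ae_differentiableAt] with x h1 h2
  exact deriv_fun_sub h1 h2

lemma sub (hf : EdgeH1 f) (hg : EdgeH1 g) : EdgeH1 fun x => f x - g x :=
  ⟨hf.ac.fun_sub hg.ac,
    (memLp_congr_ae (hf.ae_deriv_sub hg)).2 (hf.memLp_deriv.sub hg.memLp_deriv)⟩

lemma const_mul (hf : EdgeH1 f) (c : ℝ) : EdgeH1 fun x => c * f x := by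
  refine ⟨hf.ac.const_mul c, ?_⟩
  have : deriv (fun x => c * f x) = fun x => c * deriv f x := by
    ext x; exact deriv_const_mul_field c
  rw [this]
  exact hf.memLp_deriv.const_mul c

/-- The same edge run through in the opposite direction. -/
lemma reverse (hf : EdgeH1 f) : EdgeH1 fun x => f (1 - x) := by
  have hmp : MeasurePreserving (fun t : ℝ => 1 - t) (volume.restrict (Icc (0 : ℝ) 1))
      (volume.restrict (Icc (0 : ℝ) 1)) := by
    have := (Measure.measurePreserving_sub_left volume (1 : ℝ)).restrict_preimage
      (measurableSet_Icc (a := (0 : ℝ)) (b := 1))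
    simpa using this
  have hm := (hf.memLp_deriv.comp_measurePreserving hmp).neg
  refine (of_integral (c := f 1) hm fun x hx => ?_).1
  have h1 := hf.sub_eq_integral (x := 1) (y := 1 - x) (by simp) ⟨by linarith [hx.2], by
    linarith [hx.1]⟩
  have h2 : ∫ t in (0 : ℝ)..x, (-(deriv f ∘ fun t : ℝ => 1 - t)) t
      = -∫ t in (0 : ℝ)..x, deriv f (1 - t) := by
    rw [← intervalIntegral.integral_neg]; rfl
  rw [h2, intervalIntegral.integral_comp_sub_left (fun t => deriv f t), sub_zero,
    ← intervalIntegral.integral_symm, ← h1]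
  ring

lemma edgeMass_le (hf : EdgeH1 f) : edgeMass f ≤ 3 * f 0 ^ 2 + 3 / 4 * edgeKin f := by
  have hle : ∀ x ∈ Icc (0 : ℝ) 1, |f x| ^ 2 ≤ 3 * f 0 ^ 2 + 3 / 2 * edgeKin f * x := by
    intro x hx
    have := hf.sq_sub_le (left_mem_Icc.2 zero_le_one) hx
    rw [sub_zero, abs_of_nonneg hx.1] at this
    rw [sq_abs]
    nlinarith [sq_nonneg (f x - 3 * f 0)]
  have hc : Continuous fun x : ℝ => 3 * f 0 ^ 2 + 3 / 2 * edgeKin f * x := by fun_prop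
  have h1 : edgeMass f ≤ ∫ x in Icc (0 : ℝ) 1, (3 * f 0 ^ 2 + 3 / 2 * edgeKin f * x) :=
    setIntegral_mono_on hf.integrable_sq hc.continuousOn.integrableOn_Icc measurableSet_Icc hle
  have h2 : Continuous fun x : ℝ => 3 / 2 * edgeKin f * x := by fun_prop
  rw [setIntegral_unitInterval, intervalIntegral.integral_add (by simp)
    (h2.intervalIntegrable _ _), intervalIntegral.integral_const,
    intervalIntegral.integral_const_mul (3 / 2 * edgeKin f), integral_id, smul_eq_mul] at h1
  norm_num at h1
  linarith

end EdgeH1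

lemma integral_sub_sub {F G H : ℝ → ℝ} {ν : Measure ℝ} (hF : Integrable F ν)
    (hG : Integrable G ν) (hH : Integrable H ν) :
    ∫ x, F x ∂ν - ∫ x, G x ∂ν - ∫ x, H x ∂ν = ∫ x, (F x - G x - H x) ∂ν := by
  have h : Integrable (fun x => F x - G x) ν := hF.sub hG
  rw [integral_sub h hH, integral_sub hF hG]

lemma setIntegral_unitInterval_reverse (F : ℝ → ℝ) :
    ∫ x in Icc (0 : ℝ) 1, F (1 - x) = ∫ x in Icc (0 : ℝ) 1, F x := by
  simp [setIntegral_unitInterval]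

lemma edgeMass_reverse (f : ℝ → ℝ) : edgeMass (fun x => f (1 - x)) = edgeMass f :=
  setIntegral_unitInterval_reverse fun x => |f x| ^ 2

lemma edgePow_reverse (p : ℝ) (f : ℝ → ℝ) : edgePow p (fun x => f (1 - x)) = edgePow p f :=
  setIntegral_unitInterval_reverse fun x => |f x| ^ p

lemma edgeKin_reverse (f : ℝ → ℝ) : edgeKin (fun x => f (1 - x)) = edgeKin f := by
  have : ∀ x, |deriv (fun x => f (1 - x)) x| ^ 2 = |deriv f (1 - x)| ^ 2 := fun x => by
    rw [deriv_comp_const_sub, abs_neg]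
  unfold edgeKin
  simp_rw [this]
  exact setIntegral_unitInterval_reverse fun x => |deriv f x| ^ 2

lemma edgeMass_const_mul (c : ℝ) (f : ℝ → ℝ) :
    edgeMass (fun x => c * f x) = c ^ 2 * edgeMass f := by
  simp [edgeMass, mul_pow, integral_const_mul]

lemma edgeKin_const_mul (c : ℝ) (f : ℝ → ℝ) :
    edgeKin (fun x => c * f x) = c ^ 2 * edgeKin f := by
  simp [edgeKin, mul_pow, integral_const_mul]

lemma edgeMass_const (c : ℝ) : edgeMass (fun _ => c) = c ^ 2 := by simp [edgeMass]

lemma edgeKin_const (c : ℝ) : edgeKin (fun _ => c) = 0 := by simp [edgeKin]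

/-- The tent piece descending from `1` to `0` along an edge. -/
lemma edgeH1_one_sub : EdgeH1 fun x => 1 - x := by
  refine ⟨ContDiffOn.absolutelyContinuousOnInterval (by fun_prop), ?_⟩
  have : deriv (fun x : ℝ => 1 - x) = fun _ => -1 := by ext x; simp
  rw [this]
  exact memLp_const _

lemma edgeMass_one_sub : edgeMass (fun x => 1 - x) = 1 / 3 := by
  rw [edgeMass_reverse fun x => x, edgeMass, setIntegral_unitInterval]
  simp only [sq_abs, integral_pow]
  norm_num

lemma edgeKin_one_sub : edgeKin (fun x => 1 - x) = 1 := by simp [edgeKin]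

namespace EdgeH1

variable {f g : ℝ → ℝ}

lemma edgeMass_sub_split (hf : EdgeH1 f) (hg : EdgeH1 g) :
    edgeMass f - edgeMass g - edgeMass (fun x => f x - g x)
      = 2 * ∫ x in Icc (0 : ℝ) 1, g x * (f x - g x) := by
  unfold edgeMass
  rw [integral_sub_sub hf.integrable_sq hg.integrable_sq (hf.sub hg).integrable_sq,
    ← integral_const_mul]
  refine integral_congr_ae (ae_of_all _ fun x => ?_)
  simp only [sq_abs]
  ring

lemma edgeKin_sub_split (hf : EdgeH1 f) (hg : EdgeH1 g) :
    edgeKin f - edgeKin g - edgeKin (fun x => f x - g x)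
      = 2 * ∫ x in Icc (0 : ℝ) 1, deriv g x * deriv (fun x => f x - g x) x := by
  unfold edgeKin
  rw [integral_sub_sub hf.integrable_deriv_sq hg.integrable_deriv_sq
    (hf.sub hg).integrable_deriv_sq, ← integral_const_mul]
  refine integral_congr_ae ?_
  filter_upwards [hf.ae_deriv_sub hg] with x hx
  simp only [sq_abs, hx]
  ring

lemma edgeMass_sub_le (hf : EdgeH1 f) (hg : EdgeH1 g) :
    edgeMass (fun x => f x - g x) ≤ 2 * edgeMass f + 2 * edgeMass g := by
  unfold edgeMass
  rw [← integral_const_mul, ← integral_const_mul, ← integral_add (hf.integrable_sq.const_mul _)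
    (hg.integrable_sq.const_mul _)]
  refine integral_mono (hf.sub hg).integrable_sq
    ((hf.integrable_sq.const_mul _).add (hg.integrable_sq.const_mul _)) fun x => ?_
  simp only [sq_abs]
  nlinarith [sq_nonneg (f x + g x)]

lemma edgeKin_sub_le (hf : EdgeH1 f) (hg : EdgeH1 g) :
    edgeKin (fun x => f x - g x) ≤ 2 * edgeKin f + 2 * edgeKin g := by
  unfold edgeKin
  rw [← integral_const_mul, ← integral_const_mul, ← integral_add
    (hf.integrable_deriv_sq.const_mul _) (hg.integrable_deriv_sq.const_mul _)]
  refine integral_mono_ae (hf.sub hg).integrable_deriv_sq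
    ((hf.integrable_deriv_sq.const_mul _).add (hg.integrable_deriv_sq.const_mul _)) ?_
  filter_upwards [hf.ae_deriv_sub hg] with x hx
  simp only [sq_abs, hx]
  nlinarith [sq_nonneg (deriv f x + deriv g x)]

lemma edgePow_le (hf : EdgeH1 f) {p S : ℝ} (hp : 2 ≤ p)
    (hS : ∀ x ∈ Icc (0 : ℝ) 1, |f x| ≤ S) : edgePow p f ≤ S ^ (p - 2) * edgeMass f := by
  unfold edgePow edgeMass
  rw [← integral_const_mul]
  refine setIntegral_mono_on (hf.integrable_rpow (by linarith)) (hf.integrable_sq.const_mul _)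
    measurableSet_Icc fun x hx => ?_
  have h1 : |f x| ^ p = |f x| ^ (p - 2) * |f x| ^ 2 := by
    rw [← Real.rpow_natCast, ← Real.rpow_add_of_nonneg (abs_nonneg _) (by linarith) (by norm_num)]
    norm_num
  rw [h1]
  exact mul_le_mul_of_nonneg_right
    (Real.rpow_le_rpow (abs_nonneg _) (hS x hx) (by linarith)) (by positivity)

lemma edgeMass_eq_zero_of_edgePow (hf : EdgeH1 f) {p : ℝ} (hp : 0 < p) (h : edgePow p f = 0) :
    edgeMass f = 0 := by
  unfold edgePow at h
  rw [integral_eq_zero_iff_of_nonneg (fun _ => by positivity) (hf.integrable_rpow hp.le)] at h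
  refine integral_eq_zero_of_ae ?_
  filter_upwards [h] with x hx
  have : |f x| = 0 := by
    simpa [Real.rpow_eq_zero (abs_nonneg (f x)) hp.ne'] using hx
  simp [this]

lemma edgeMass_pos (hf : EdgeH1 f) {x : ℝ} (hx : x ∈ Icc (0 : ℝ) 1) (h : f x ≠ 0) :
    0 < edgeMass f := by
  refine (edgeMass_nonneg f).lt_of_ne fun h0 => h ?_
  have := hf.sq_le hx
  rw [← h0] at this
  simpa using this

end EdgeH1

/-! ### An elementary inequality for powers -/

lemma abs_rpow_sub_rpow_le {p : ℝ} (hp : 1 ≤ p) {s t R : ℝ} (hs : 0 ≤ s) (ht : 0 ≤ t)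
    (hsR : s ≤ R) (htR : t ≤ R) : |s ^ p - t ^ p| ≤ p * R ^ (p - 1) * |s - t| := by
  have := Convex.norm_image_sub_le_of_norm_deriv_le (𝕜 := ℝ) (f := fun x : ℝ => x ^ p)
    (s := Icc 0 R) (C := p * R ^ (p - 1)) (x := t) (y := s)
    (fun x _ => (Real.hasDerivAt_rpow_const (Or.inr hp)).differentiableAt)
    (fun x hx => by
      rw [Real.deriv_rpow_const, Real.norm_eq_abs, abs_mul, abs_of_nonneg (by linarith),
        abs_of_nonneg (Real.rpow_nonneg hx.1 _)]
      exact mul_le_mul_of_nonneg_left (Real.rpow_le_rpow hx.1 hx.2 (by linarith)) (by linarith))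
    (convex_Icc _ _) ⟨ht, htR⟩ ⟨hs, hsR⟩
  simpa using this

/-- The failure of additivity of `|·|^p` is controlled by the product, on bounded sets. -/
lemma abs_rpow_add_sub_le {p : ℝ} (hp : 2 ≤ p) {a b B : ℝ} (ha : |a| ≤ B) (hb : |b| ≤ B) :
    |(|a + b| ^ p - |a| ^ p - |b| ^ p)| ≤ (p * 2 ^ p * B ^ (p - 2)) * (|a| * |b|) := by
  wlog hab : |b| ≤ |a| generalizing a b
  · have := this hb ha (le_of_not_ge hab)
    rw [add_comm b a, sub_right_comm] at this
    rwa [mul_comm |a|]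
  have hB : 0 ≤ B := (abs_nonneg a).trans ha
  have hsplit : ∀ {t q : ℝ}, 0 ≤ t → 1 ≤ q → t ^ q = t ^ (q - 1) * t := fun {t q} h hq => by
    rw [← Real.rpow_add_one' h (by linarith), sub_add_cancel]
  have h1 := abs_rpow_sub_rpow_le (p := p) (R := 2 * |a|) (by linarith) (abs_nonneg (a + b))
    (abs_nonneg a) ((abs_add_le a b).trans (by linarith)) (by linarith [abs_nonneg a])
  have h2 : |(|a + b| - |a|)| ≤ |b| := by
    simpa using abs_abs_sub_abs_le_abs_sub (a + b) a
  have h3 : |a| ^ (p - 1) ≤ B ^ (p - 2) * |a| := by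
    rw [hsplit (abs_nonneg a) (by linarith), show p - 1 - 1 = p - 2 by ring]
    gcongr
  have h4 : |b| ^ p ≤ B ^ (p - 2) * |a| * |b| := by
    rw [hsplit (abs_nonneg b) (by linarith)]
    gcongr
    exact (Real.rpow_le_rpow (abs_nonneg b) hab (by linarith)).trans h3
  have h5 : p * (2 * |a|) ^ (p - 1) * |(|a + b| - |a|)|
      ≤ p * (2 ^ (p - 1) * (B ^ (p - 2) * |a|)) * |b| := by
    rw [Real.mul_rpow (by norm_num) (abs_nonneg a)]
    gcongr
  have h6 : (2 : ℝ) ^ p = 2 ^ (p - 1) * 2 := hsplit (by norm_num) (by linarith)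
  have h7 : (1 : ℝ) ≤ 2 ^ (p - 1) := Real.one_le_rpow (by norm_num) (by linarith)
  have h8 : 0 ≤ B ^ (p - 2) * |a| * |b| := by positivity
  have h9 : |(|a + b| ^ p - |a| ^ p - |b| ^ p)| ≤ |(|a + b| ^ p - |a| ^ p)| + |b| ^ p := by
    refine (abs_sub _ _).trans_eq ?_
    rw [abs_of_nonneg (Real.rpow_nonneg (abs_nonneg b) p)]
  rw [h6]
  nlinarith [mul_nonneg (sub_nonneg.2 h7) h8, mul_nonneg (by linarith : 0 ≤ p - 2)
    (mul_nonneg (by linarith : (0:ℝ) ≤ 2 ^ (p - 1)) h8)]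

lemma EdgeH1.abs_edgePow_sub_split_le {f g : ℝ → ℝ} (hf : EdgeH1 f) (hg : EdgeH1 g) {p B : ℝ}
    (hp : 2 ≤ p) (hfg : ∀ x ∈ Icc (0 : ℝ) 1, |f x - g x| ≤ B)
    (hgB : ∀ x ∈ Icc (0 : ℝ) 1, |g x| ≤ B) :
    |edgePow p f - edgePow p g - edgePow p (fun x => f x - g x)|
      ≤ (p * 2 ^ p * B ^ (p - 2)) * ∫ x in Icc (0 : ℝ) 1, |g x * (f x - g x)| := by
  have hp0 : 0 ≤ p := by linarith
  unfold edgePow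
  rw [integral_sub_sub (hf.integrable_rpow hp0) (hg.integrable_rpow hp0)
    ((hf.sub hg).integrable_rpow hp0), ← integral_const_mul]
  refine (abs_integral_le_integral_abs).trans ?_
  refine setIntegral_mono_on (((hf.integrable_rpow hp0).sub (hg.integrable_rpow hp0)).sub
    ((hf.sub hg).integrable_rpow hp0)).abs ((hg.integrable_mul (hf.sub hg)).abs.const_mul _)
    measurableSet_Icc fun x hx => ?_
  have := abs_rpow_add_sub_le hp (hgB x hx) (hfg x hx)
  rw [abs_mul]
  simpa using this

/-! ### Functionals on a metric graph as sums over the edges -/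

namespace UnitMetricGraph

variable {G : UnitMetricGraph}

instance instDiscreteMeasurableSpaceEdge (G : UnitMetricGraph) :
    DiscreteMeasurableSpace G.Edge := ⟨fun _ => trivial⟩

lemma measurableEmbedding_edge (e : G.Edge) :
    MeasurableEmbedding (Prod.mk e : ℝ → G.Edge × ℝ) :=
  measurableEmbedding_prodMk_left e

lemma lengthMeasure_eq_sum (G : UnitMetricGraph) : G.lengthMeasure =
    Measure.sum fun e : G.Edge => (volume.restrict (Icc (0 : ℝ) 1)).map (Prod.mk e) := by
  rw [lengthMeasure, Measure.count, Measure.prod_sum_left]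
  simp_rw [Measure.dirac_prod]

lemma integrable_lengthMeasure_iff {F : G.Edge × ℝ → ℝ} : Integrable F G.lengthMeasure ↔
    (∀ e, Integrable (fun x => F (e, x)) (volume.restrict (Icc (0 : ℝ) 1))) ∧
      Summable fun e => ∫ x in Icc (0 : ℝ) 1, |F (e, x)| := by
  rw [lengthMeasure_eq_sum, integrable_sum_measure_iff]
  simp_rw [(measurableEmbedding_edge _).integrable_map_iff,
    (measurableEmbedding_edge _).integral_map, Real.norm_eq_abs, Function.comp_def]

lemma hasSum_integral_lengthMeasure {F : G.Edge × ℝ → ℝ} (hF : Integrable F G.lengthMeasure) :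
    HasSum (fun e => ∫ x in Icc (0 : ℝ) 1, F (e, x)) (∫ z, F z ∂G.lengthMeasure) := by
  rw [lengthMeasure_eq_sum] at hF ⊢
  have := hasSum_integral_measure hF
  simpa only [(measurableEmbedding_edge _).integral_map] using this

lemma aestronglyMeasurable_lengthMeasure_iff {F : G.Edge × ℝ → ℝ} :
    AEStronglyMeasurable F G.lengthMeasure ↔
      ∀ e, AEStronglyMeasurable (fun x => F (e, x)) (volume.restrict (Icc (0 : ℝ) 1)) := by
  rw [lengthMeasure_eq_sum, aestronglyMeasurable_sum_measure_iff]
  simp_rw [(measurableEmbedding_edge _).aestronglyMeasurable_map_iff, Function.comp_def]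

lemma memLp_two_lengthMeasure_iff {F : G.Edge × ℝ → ℝ} : MemLp F 2 G.lengthMeasure ↔
    (∀ e, MemLp (fun x => F (e, x)) 2 (volume.restrict (Icc (0 : ℝ) 1))) ∧
      Summable fun e => ∫ x in Icc (0 : ℝ) 1, |F (e, x)| ^ 2 := by
  constructor
  · intro h
    have h1 := aestronglyMeasurable_lengthMeasure_iff.1 h.1
    have h2 := integrable_lengthMeasure_iff.1 ((memLp_two_iff_integrable_sq h.1).1 h)
    exact ⟨fun e => (memLp_two_iff_integrable_sq (h1 e)).2 (h2.1 e), by simpa using h2.2⟩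
  · intro h
    have h1 := aestronglyMeasurable_lengthMeasure_iff.2 fun e => (h.1 e).1
    refine (memLp_two_iff_integrable_sq h1).2 (integrable_lengthMeasure_iff.2
      ⟨fun e => (memLp_two_iff_integrable_sq (h.1 e).1).1 (h.1 e), by simpa using h.2⟩)

/-- The nonlinear term `∫_G |u|^p dx`. -/
noncomputable def power (G : UnitMetricGraph) (p : ℝ) (u : G.Edge → ℝ → ℝ) : ℝ :=
  ∫ z, |u z.1 z.2| ^ p ∂G.lengthMeasure

lemma energy_eq (p : ℝ) (u : G.Edge → ℝ → ℝ) :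
    G.energy p u = 1 / 2 * G.kinetic u - 1 / p * G.power p u := rfl

lemma mass_nonneg (u : G.Edge → ℝ → ℝ) : 0 ≤ G.mass u := integral_nonneg fun _ => by positivity

lemma kinetic_nonneg (u : G.Edge → ℝ → ℝ) : 0 ≤ G.kinetic u :=
  integral_nonneg fun _ => by positivity

lemma power_nonneg (p : ℝ) (u : G.Edge → ℝ → ℝ) : 0 ≤ G.power p u :=
  integral_nonneg fun _ => by positivity

/-- Membership in `H¹(G)`, edge by edge. -/
lemma memH1_iff {u : G.Edge → ℝ → ℝ} : G.MemH1 u ↔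
    (∃ φ : G.Vertex → ℝ, ∀ e, u e 0 = φ (G.src e) ∧ u e 1 = φ (G.tgt e)) ∧
    (∀ e, EdgeH1 (u e)) ∧ Summable (fun e => edgeMass (u e)) ∧
      Summable fun e => edgeKin (u e) := by
  constructor
  · intro h
    have h1 := memLp_two_lengthMeasure_iff.1 h.memLp
    have h2 := memLp_two_lengthMeasure_iff.1 h.memLp_deriv
    exact ⟨h.1, fun e => ⟨h.2 e, h2.1 e⟩, h1.2, h2.2⟩
  · rintro ⟨h1, h2, h3, h4⟩
    exact ⟨h1, fun e => (h2 e).ac, memLp_two_lengthMeasure_iff.2 ⟨fun e => (h2 e).memLp 2, h3⟩,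
      memLp_two_lengthMeasure_iff.2 ⟨fun e => (h2 e).memLp_deriv, h4⟩⟩

namespace MemH1

variable {u v : G.Edge → ℝ → ℝ}

lemma edge (hu : G.MemH1 u) (e : G.Edge) : EdgeH1 (u e) := (memH1_iff.1 hu).2.1 e

lemma hasSum_mass (hu : G.MemH1 u) : HasSum (fun e => edgeMass (u e)) (G.mass u) := by
  refine hasSum_integral_lengthMeasure (F := fun z => |u z.1 z.2| ^ 2)
    (integrable_lengthMeasure_iff.2 ⟨fun e => (hu.edge e).integrable_sq, ?_⟩)
  simpa [edgeMass] using (memH1_iff.1 hu).2.2.1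

lemma hasSum_kinetic (hu : G.MemH1 u) : HasSum (fun e => edgeKin (u e)) (G.kinetic u) := by
  refine hasSum_integral_lengthMeasure (F := fun z => |deriv (u z.1) z.2| ^ 2)
    (integrable_lengthMeasure_iff.2 ⟨fun e => (hu.edge e).integrable_deriv_sq, ?_⟩)
  simpa [edgeKin] using (memH1_iff.1 hu).2.2.2

lemma edgeMass_le_mass (hu : G.MemH1 u) (e : G.Edge) : edgeMass (u e) ≤ G.mass u :=
  le_hasSum hu.hasSum_mass e fun _ _ => edgeMass_nonneg _

lemma edgeKin_le_kinetic (hu : G.MemH1 u) (e : G.Edge) : edgeKin (u e) ≤ G.kinetic u :=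
  le_hasSum hu.hasSum_kinetic e fun _ _ => edgeKin_nonneg _

/-- The sup norm is controlled by the mass and the Dirichlet integral. -/
lemma sq_le (hu : G.MemH1 u) (e : G.Edge) {x : ℝ} (hx : x ∈ Icc (0 : ℝ) 1) :
    u e x ^ 2 ≤ G.mass u + 2 * √(G.mass u * G.kinetic u) := by
  refine ((hu.edge e).sq_le hx).trans ?_
  have := mul_le_mul (hu.edgeMass_le_mass e) (hu.edgeKin_le_kinetic e) (edgeKin_nonneg _)
    (mass_nonneg u)
  gcongr
  exact hu.edgeMass_le_mass e

lemma abs_le (hu : G.MemH1 u) (e : G.Edge) {x : ℝ} (hx : x ∈ Icc (0 : ℝ) 1) :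
    |u e x| ≤ √(G.mass u + 2 * √(G.mass u * G.kinetic u)) :=
  Real.abs_le_sqrt (hu.sq_le e hx)

lemma hasSum_power (hu : G.MemH1 u) {p : ℝ} (hp : 2 ≤ p) :
    HasSum (fun e => edgePow p (u e)) (G.power p u) := by
  refine hasSum_integral_lengthMeasure (F := fun z => |u z.1 z.2| ^ p)
    (integrable_lengthMeasure_iff.2 ⟨fun e => (hu.edge e).integrable_rpow (by linarith), ?_⟩)
  have : ∀ e, ∫ x in Icc (0 : ℝ) 1, |(|u e x| ^ p)| = edgePow p (u e) := fun e => by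
    simp only [edgePow, abs_of_nonneg (Real.rpow_nonneg (abs_nonneg _) _)]
  simp_rw [this]
  exact Summable.of_nonneg_of_le (fun e => edgePow_nonneg _ _)
    (fun e => (hu.edge e).edgePow_le hp fun x hx => hu.abs_le e hx)
    (hu.hasSum_mass.summable.mul_left _)

lemma power_le (hu : G.MemH1 u) {p S : ℝ} (hp : 2 ≤ p)
    (hS : ∀ e, ∀ x ∈ Icc (0 : ℝ) 1, |u e x| ≤ S) : G.power p u ≤ S ^ (p - 2) * G.mass u :=
  hasSum_le (fun e => (hu.edge e).edgePow_le hp (hS e)) (hu.hasSum_power hp)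
    (hu.hasSum_mass.mul_left _)

lemma mass_eq_zero_of_power (hu : G.MemH1 u) {p : ℝ} (hp : 2 ≤ p) (h : G.power p u = 0) :
    G.mass u = 0 := by
  have h1 := hu.hasSum_power hp
  rw [h, hasSum_zero_iff_of_nonneg fun _ => edgePow_nonneg _ _] at h1
  have h2 : (fun e => edgeMass (u e)) = fun _ => 0 := funext fun e =>
    (hu.edge e).edgeMass_eq_zero_of_edgePow (by linarith) (congrFun h1 e)
  have h3 := hu.hasSum_mass
  rw [h2] at h3
  exact h3.unique hasSum_zero

lemma power_pos (hu : G.MemH1 u) {p : ℝ} (hp : 2 ≤ p) (h : G.mass u ≠ 0) : 0 < G.power p u :=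
  (power_nonneg p u).lt_of_ne fun h0 => h (hu.mass_eq_zero_of_power hp h0.symm)

lemma const_mul (hu : G.MemH1 u) (c : ℝ) : G.MemH1 fun e x => c * u e x := by
  obtain ⟨⟨φ, hφ⟩, h2, h3, h4⟩ := memH1_iff.1 hu
  refine memH1_iff.2 ⟨⟨fun v => c * φ v, fun e => ⟨by rw [(hφ e).1], by rw [(hφ e).2]⟩⟩,
    fun e => (h2 e).const_mul c, ?_, ?_⟩
  · simpa only [edgeMass_const_mul] using h3.mul_left _
  · simpa only [edgeKin_const_mul] using h4.mul_left _

lemma sub (hu : G.MemH1 u) (hv : G.MemH1 v) : G.MemH1 fun e x => u e x - v e x := by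
  obtain ⟨⟨φ, hφ⟩, h2, h3, h4⟩ := memH1_iff.1 hu
  obtain ⟨⟨ψ, hψ⟩, k2, k3, k4⟩ := memH1_iff.1 hv
  refine memH1_iff.2 ⟨⟨fun v => φ v - ψ v, fun e =>
    ⟨by rw [(hφ e).1, (hψ e).1], by rw [(hφ e).2, (hψ e).2]⟩⟩, fun e => (h2 e).sub (k2 e), ?_, ?_⟩
  · exact Summable.of_nonneg_of_le (fun _ => edgeMass_nonneg _)
      (fun e => (h2 e).edgeMass_sub_le (k2 e)) ((h3.mul_left _).add (k3.mul_left _))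
  · exact Summable.of_nonneg_of_le (fun _ => edgeKin_nonneg _)
      (fun e => (h2 e).edgeKin_sub_le (k2 e)) ((h4.mul_left _).add (k4.mul_left _))

end MemH1

lemma mass_const_mul (c : ℝ) (u : G.Edge → ℝ → ℝ) :
    G.mass (fun e x => c * u e x) = c ^ 2 * G.mass u := by
  simp [mass, mul_pow, integral_const_mul]

lemma kinetic_const_mul (c : ℝ) (u : G.Edge → ℝ → ℝ) :
    G.kinetic (fun e x => c * u e x) = c ^ 2 * G.kinetic u := by
  simp [kinetic, mul_pow, integral_const_mul]

lemma power_const_mul (p c : ℝ) (u : G.Edge → ℝ → ℝ) :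
    G.power p (fun e x => c * u e x) = |c| ^ p * G.power p u := by
  simp [power, abs_mul, Real.mul_rpow, integral_const_mul]

/-- Scaling the amplitude by `c`, with the gain of the superquadratic term made explicit. -/
lemma energy_const_mul {p : ℝ} {c : ℝ} (hc : 0 < c) (u : G.Edge → ℝ → ℝ) :
    G.energy p (fun e x => c * u e x) =
      c ^ 2 * (G.energy p u - 1 / p * ((c ^ (p - 2) - 1) * G.power p u)) := by
  rw [energy_eq, energy_eq, kinetic_const_mul, power_const_mul, abs_of_pos hc]
  have : c ^ p = c ^ 2 * c ^ (p - 2) := by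
    rw [← Real.rpow_natCast, ← Real.rpow_add hc]; norm_num
  rw [this]; ring

end UnitMetricGraph

/-! ### The energy level as a function of the mass -/

lemma exists_mul_rpow_le {A θ : ℝ} (hA : 0 ≤ A) (h0 : 0 ≤ θ) (h1 : θ < 1) :
    ∃ B, ∀ t : ℝ, 0 ≤ t → A * t ^ θ ≤ t / 4 + B := by
  set b : ℝ := (A * 4 ^ θ) ^ (1 / (1 - θ)) with hb
  have hb0 : 0 ≤ b := by positivity
  refine ⟨b, fun t ht => ?_⟩
  have h := Real.geom_mean_le_arith_mean2_weighted h0 (by linarith : 0 ≤ 1 - θ)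
    (by positivity : 0 ≤ t / 4) hb0 (by ring)
  have h2 : b ^ (1 - θ) = A * 4 ^ θ := by
    rw [hb, ← Real.rpow_mul (by positivity), one_div_mul_cancel (by linarith), Real.rpow_one]
  rw [h2, Real.div_rpow ht (by norm_num)] at h
  have h3 : t ^ θ / 4 ^ θ * (A * 4 ^ θ) = A * t ^ θ := by
    field_simp
  rw [h3] at h
  nlinarith

namespace UnitMetricGraph

variable {G : UnitMetricGraph} {p lam : ℝ} {u : G.Edge → ℝ → ℝ}

/-- For masses in a bounded range, the nonlinear term is absorbed by the Dirichlet integral: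
this is where the subcriticality `p < 6` enters. -/
lemma exists_power_le (hp2 : 2 < p) (hp6 : p < 6) {m : ℝ} (hm : 0 ≤ m) :
    ∃ B, ∀ u : G.Edge → ℝ → ℝ, G.MemH1 u → G.mass u ≤ m →
      1 / p * G.power p u ≤ 1 / 4 * G.kinetic u + B := by
  obtain ⟨B, hB⟩ := exists_mul_rpow_le (A := 1 / p * ((m + 2 * √m) ^ ((p - 2) / 2) * m))
    (θ := (p - 2) / 4) (by positivity) (by linarith) (by linarith)
  refine ⟨B + 1 / 4, fun u hu hum => ?_⟩
  set K := G.kinetic u with hK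
  have hK0 : 0 ≤ K := kinetic_nonneg u
  have hM0 := mass_nonneg u
  have hs : ∀ e, ∀ x ∈ Icc (0 : ℝ) 1, |u e x| ≤ √((m + 2 * √m) * √(1 + K)) := by
    intro e x hx
    refine (hu.abs_le e hx).trans (Real.sqrt_le_sqrt ?_)
    have h1 : √(G.mass u * K) ≤ √m * √(1 + K) := by
      rw [← Real.sqrt_mul hm]
      exact Real.sqrt_le_sqrt (mul_le_mul hum (by linarith) hK0 hm)
    have h2 : 1 ≤ √(1 + K) := Real.one_le_sqrt.2 (by linarith)
    nlinarith [mul_le_mul_of_nonneg_left h2 hm]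
  have h1 := hu.power_le hp2.le hs
  have h2 : √((m + 2 * √m) * √(1 + K)) ^ (p - 2)
      = (m + 2 * √m) ^ ((p - 2) / 2) * (1 + K) ^ ((p - 2) / 4) := by
    rw [Real.sqrt_eq_rpow, ← Real.rpow_mul (by positivity), Real.mul_rpow (by positivity)
      (by positivity), Real.sqrt_eq_rpow (1 + K), ← Real.rpow_mul (by positivity)]
    ring_nf
  rw [h2] at h1
  have h3 := hB (1 + K) (by linarith)
  have h4 : 1 / p * G.power p u ≤ 1 / p * ((m + 2 * √m) ^ ((p - 2) / 2) * m) *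
      (1 + K) ^ ((p - 2) / 4) := by
    rw [mul_assoc]
    refine mul_le_mul_of_nonneg_left (h1.trans ?_) (by positivity)
    calc _ ≤ (m + 2 * √m) ^ ((p - 2) / 2) * (1 + K) ^ ((p - 2) / 4) * m := by gcongr
      _ = _ := by ring
  linarith

/-- `lam` is the bottom of the spectrum of `G`, and it is positive. -/
structure SpectralGap (G : UnitMetricGraph) (lam : ℝ) : Prop where
  pos : 0 < lam
  le : ∀ u, G.MemH1 u → lam * G.mass u ≤ G.kinetic u
  sharp : ∀ ε > 0, ∃ u, G.MemH1 u ∧ G.mass u ≠ 0 ∧ G.kinetic u < (lam + ε) * G.mass u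

/-- Rescaling the amplitude to a prescribed larger mass lowers the energy per unit mass. -/
lemma MemH1.exists_scale (hu : G.MemH1 u) (hp2 : 2 < p) (hM : 0 < G.mass u) {μ : ℝ}
    (hμ : G.mass u ≤ μ) : ∃ v ∈ G.H1mass μ, G.energy p v ≤ μ / G.mass u * G.energy p u ∧
      (G.mass u < μ → G.energy p v < μ / G.mass u * G.energy p u) := by
  set c := √(μ / G.mass u) with hc
  have hc1 : 1 ≤ μ / G.mass u := (one_le_div hM).2 hμ
  have hc2 : c ^ 2 = μ / G.mass u := Real.sq_sqrt (by linarith)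
  have hc3 : 1 ≤ c := Real.one_le_sqrt.2 hc1
  have hP := hu.power_pos hp2.le hM.ne'
  have hc4 : 1 ≤ c ^ (p - 2) := Real.one_le_rpow hc3 (by linarith)
  have hp : 0 < 1 / p := by positivity
  refine ⟨fun e x => c * u e x, ⟨hu.const_mul c, ?_⟩, ?_, fun hlt => ?_⟩
  · rw [mass_const_mul, hc2, div_mul_cancel₀ _ hM.ne']
  · rw [energy_const_mul (by linarith), hc2]
    have : 0 ≤ 1 / p * ((c ^ (p - 2) - 1) * G.power p u) :=
      mul_nonneg hp.le (mul_nonneg (by linarith) hP.le)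
    exact mul_le_mul_of_nonneg_left (by linarith) (by linarith)
  · rw [energy_const_mul (by linarith), hc2]
    have hc5 : 1 < c ^ (p - 2) := by
      refine Real.one_lt_rpow ?_ (by linarith)
      rw [hc, Real.lt_sqrt zero_le_one, one_pow]
      exact (one_lt_div hM).2 hlt
    have : 0 < 1 / p * ((c ^ (p - 2) - 1) * G.power p u) :=
      mul_pos hp (mul_pos (by linarith) hP)
    exact mul_lt_mul_of_pos_left (by linarith) (by linarith)

lemma MemH1.exists_mass_eq (hu : G.MemH1 u) (hM : G.mass u ≠ 0) {μ : ℝ} (hμ : 0 ≤ μ) :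
    ∃ v ∈ G.H1mass μ, G.kinetic v = μ / G.mass u * G.kinetic u := by
  have h := (mass_nonneg u).lt_of_ne' hM
  have hc : √(μ / G.mass u) ^ 2 = μ / G.mass u := Real.sq_sqrt (by positivity)
  refine ⟨fun e x => √(μ / G.mass u) * u e x, ⟨hu.const_mul _, ?_⟩, ?_⟩
  · rw [mass_const_mul, hc, div_mul_cancel₀ _ hM]
  · rw [kinetic_const_mul, hc]

lemma energy_le_half_kinetic (hp : 0 < p) (u : G.Edge → ℝ → ℝ) :
    G.energy p u ≤ 1 / 2 * G.kinetic u := by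
  have : 0 ≤ 1 / p * G.power p u := mul_nonneg (by positivity) (power_nonneg p u)
  rw [energy_eq]; linarith

lemma MemH1.power_eq_zero (hu : G.MemH1 u) (hp2 : 2 < p) (hM : G.mass u = 0) :
    G.power p u = 0 := by
  have := hu.power_le hp2.le fun e x hx => hu.abs_le e hx
  rw [hM, mul_zero] at this
  exact this.antisymm (power_nonneg p u)

section Level

variable (hp2 : 2 < p) (hp6 : p < 6)
include hp2 hp6

lemma bddBelow_energy (μ : ℝ) : BddBelow (G.energy p '' G.H1mass μ) := by
  rcases lt_or_ge μ 0 with h | h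
  · have : G.H1mass μ = ∅ := by
      ext u
      simp only [H1mass, mem_ofPred_eq, mem_empty_iff_false, iff_false, not_and]
      intro _ hu
      exact absurd (mass_nonneg u) (by linarith)
    simp [this]
  · obtain ⟨B, hB⟩ := exists_power_le (G := G) hp2 hp6 h
    refine ⟨-B, ?_⟩
    rintro _ ⟨u, hu, rfl⟩
    have h1 := hB u hu.1 hu.2.le
    have h2 := kinetic_nonneg u
    rw [energy_eq]
    linarith

lemma level_le_energy {μ : ℝ} (hu : u ∈ G.H1mass μ) : G.level p μ ≤ G.energy p u :=
  csInf_le (bddBelow_energy hp2 hp6 μ) (mem_image_of_mem _ hu)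

/-- Sub-linearity of the level: the energy per unit mass decreases with the mass. -/
lemma MemH1.ratio_mul_level_le {μ : ℝ} (hu : G.MemH1 u) (hμ : 0 < μ) (h : G.mass u ≤ μ) :
    G.mass u / μ * G.level p μ ≤ G.energy p u := by
  rcases (mass_nonneg u).eq_or_lt with h0 | h0
  · rw [← h0, energy_eq, hu.power_eq_zero hp2 h0.symm]
    have := kinetic_nonneg u
    simp
    linarith
  · obtain ⟨v, hv, hv1, -⟩ := hu.exists_scale hp2 h0 h
    have h1 := level_le_energy hp2 hp6 hv
    calc _ ≤ G.mass u / μ * (μ / G.mass u * G.energy p u) := by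
          gcongr; exact h1.trans hv1
      _ = _ := by field_simp

lemma MemH1.ratio_mul_level_lt {μ : ℝ} (hu : G.MemH1 u) (h0 : 0 < G.mass u)
    (h : G.mass u < μ) : G.mass u / μ * G.level p μ < G.energy p u := by
  obtain ⟨v, hv, -, hv1⟩ := hu.exists_scale hp2 h0 h.le
  have h1 := level_le_energy hp2 hp6 hv
  have hμ : 0 < μ := h0.trans h
  calc _ < G.mass u / μ * (μ / G.mass u * G.energy p u) := by
        gcongr; exact h1.trans_lt (hv1 h)
    _ = _ := by field_simp

end Level

namespace SpectralGap

variable (hG : G.SpectralGap lam) (hp2 : 2 < p) (hp6 : p < 6)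
include hG

lemma nonempty_H1mass {μ : ℝ} (hμ : 0 ≤ μ) : (G.H1mass μ).Nonempty := by
  obtain ⟨u, hu, hM, -⟩ := hG.sharp 1 one_pos
  obtain ⟨v, hv, -⟩ := hu.exists_mass_eq hM hμ
  exact ⟨v, hv⟩

include hp2 hp6

lemma isGLB_level {μ : ℝ} (hμ : 0 ≤ μ) : IsGLB (G.energy p '' G.H1mass μ) (G.level p μ) :=
  isGLB_csInf ((hG.nonempty_H1mass hμ).image _) (bddBelow_energy hp2 hp6 μ)

omit hp2 hp6 in
lemma exists_energy_lt {μ a : ℝ} (hμ : 0 ≤ μ) (ha : G.level p μ < a) :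
    ∃ u ∈ G.H1mass μ, G.energy p u < a := by
  obtain ⟨_, ⟨u, hu, rfl⟩, h⟩ := exists_lt_of_csInf_lt ((hG.nonempty_H1mass hμ).image _) ha
  exact ⟨u, hu, h⟩

lemma level_le {μ : ℝ} (hμ : 0 ≤ μ) : G.level p μ ≤ 1 / 2 * lam * μ := by
  refine le_of_forall_pos_le_add fun ε hε => ?_
  obtain ⟨u, hu, hM, hK⟩ := hG.sharp (ε / (μ + 1)) (by positivity)
  obtain ⟨v, hv, hvK⟩ := hu.exists_mass_eq hM hμ
  have hM' := (mass_nonneg u).lt_of_ne' hM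
  have h1 : G.kinetic v ≤ (lam + ε / (μ + 1)) * μ := by
    rw [hvK]
    calc _ ≤ μ / G.mass u * ((lam + ε / (μ + 1)) * G.mass u) := by gcongr
      _ = _ := by field_simp
  have h2 := (level_le_energy hp2 hp6 hv).trans (energy_le_half_kinetic (by linarith) v)
  have h3 : ε / (μ + 1) * μ ≤ ε := by
    rw [div_mul_eq_mul_div, div_le_iff₀ (by linarith)]
    nlinarith
  linarith

lemma level_eq_iff {μ : ℝ} (hμ : 0 ≤ μ) :
    G.level p μ = 1 / 2 * lam * μ ↔ ∀ u ∈ G.H1mass μ, 1 / 2 * lam * μ ≤ G.energy p u := by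
  constructor
  · intro h u hu
    rw [← h]
    exact level_le_energy hp2 hp6 hu
  · intro h
    refine (hG.level_le hp2 hp6 hμ).antisymm (le_csInf ((hG.nonempty_H1mass hμ).image _) ?_)
    rintro _ ⟨u, hu, rfl⟩
    exact h u hu

lemma level_eq_of_le {μ ν : ℝ} (hν : 0 ≤ ν) (hνμ : ν ≤ μ)
    (h : G.level p μ = 1 / 2 * lam * μ) : G.level p ν = 1 / 2 * lam * ν := by
  rw [hG.level_eq_iff hp2 hp6 hν]
  intro u hu
  rcases hν.eq_or_lt with rfl | h0
  · have := kinetic_nonneg u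
    rw [energy_eq, hu.1.power_eq_zero hp2 hu.2]
    simp
    linarith
  · have hμ : 0 < μ := h0.trans_le hνμ
    have := hu.1.ratio_mul_level_le hp2 hp6 hμ (hu.2.le.trans hνμ)
    rw [h, hu.2] at this
    calc _ = ν / μ * (1 / 2 * lam * μ) := by field_simp
      _ ≤ _ := this

lemma level_zero : G.level p 0 = 1 / 2 * lam * 0 := by
  rw [hG.level_eq_iff hp2 hp6 le_rfl]
  intro u hu
  have := kinetic_nonneg u
  rw [energy_eq, hu.1.power_eq_zero hp2 hu.2]
  simp
  linarith

/-- The masses with linear level form a compact interval `[0, μ*]`. -/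
lemma isGreatest_sSup : IsGreatest {μ | 0 ≤ μ ∧ G.level p μ = 1 / 2 * lam * μ}
    (sSup {μ | 0 ≤ μ ∧ G.level p μ = 1 / 2 * lam * μ}) := by
  set S := {μ | 0 ≤ μ ∧ G.level p μ = 1 / 2 * lam * μ} with hS
  have h0 : (0 : ℝ) ∈ S := ⟨le_rfl, hG.level_zero hp2 hp6⟩
  have hlam := hG.pos
  -- the energy of `c u` as a function of the amplitude `c`
  have hray : ∀ u, G.MemH1 u → ∀ c : ℝ, 0 < c → c ^ 2 * G.mass u ∈ S →
      1 / 2 * lam * G.mass u ≤ 1 / 2 * G.kinetic u - c ^ (p - 2) * (1 / p * G.power p u) := by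
    intro u hu c hc hcS
    have := (hG.level_eq_iff hp2 hp6 hcS.1).1 hcS.2 (fun e x => c * u e x)
      ⟨hu.const_mul c, mass_const_mul c u⟩
    rw [energy_const_mul hc, energy_eq] at this
    have hc2 : 0 < c ^ 2 := by positivity
    refine le_of_mul_le_mul_left ?_ hc2
    linarith
  have hbdd : BddAbove S := by
    obtain ⟨u, hu, hM, -⟩ := hG.sharp 1 one_pos
    have hM' := (mass_nonneg u).lt_of_ne' hM
    have hP : 0 < 1 / p * G.power p u :=
      mul_pos (by positivity) (hu.power_pos hp2.le hM)
    have ht := (tendsto_rpow_atTop (by linarith : 0 < p - 2)).atTop_mul_const hP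
    obtain ⟨c, hc1, hc2⟩ := ((ht.eventually_gt_atTop (1 / 2 * G.kinetic u)).and
      (Filter.eventually_gt_atTop 0)).exists
    refine ⟨c ^ 2 * G.mass u, fun μ hμ => ?_⟩
    by_contra! hlt
    have hin : c ^ 2 * G.mass u ∈ S :=
      ⟨by positivity, hG.level_eq_of_le hp2 hp6 (by positivity) hlt.le hμ.2⟩
    have := hray u hu c hc2 hin
    have : 0 < 1 / 2 * lam * G.mass u := by positivity
    linarith
  refine ⟨?_, fun μ hμ => le_csSup hbdd hμ⟩
  set μ := sSup S with hμ
  have hμ0 : 0 ≤ μ := le_csSup hbdd h0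
  refine ⟨hμ0, ?_⟩
  rcases hμ0.eq_or_lt with h | hpos
  · rw [← h]; exact hG.level_zero hp2 hp6
  rw [hG.level_eq_iff hp2 hp6 hμ0]
  intro u hu
  have hle : ∀ c ∈ Ioo (0 : ℝ) 1,
      1 / 2 * lam * μ ≤ 1 / 2 * G.kinetic u - c ^ (p - 2) * (1 / p * G.power p u) := by
    intro c hc
    have hc2 : c ^ 2 < 1 := by nlinarith [hc.1, hc.2]
    obtain ⟨ν, hν, hlt⟩ := exists_lt_of_lt_csSup ⟨0, h0⟩ (show c ^ 2 * μ < sSup S by nlinarith)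
    have := hray u hu.1 c hc.1 ⟨by rw [hu.2]; positivity,
      hG.level_eq_of_le hp2 hp6 (by rw [hu.2]; positivity) (by rw [hu.2]; exact hlt.le) hν.2⟩
    rwa [hu.2] at this
  have hcont : Filter.Tendsto
      (fun c : ℝ => 1 / 2 * G.kinetic u - c ^ (p - 2) * (1 / p * G.power p u))
      (nhdsWithin 1 (Iio 1))
      (nhds (1 / 2 * G.kinetic u - 1 ^ (p - 2) * (1 / p * G.power p u))) := by
    refine Filter.Tendsto.mono_left ?_ nhdsWithin_le_nhds
    exact tendsto_const_nhds.sub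
      (((Real.continuousAt_rpow_const 1 (p - 2) (Or.inl one_ne_zero)).tendsto).mul_const _)
  have hfin := ge_of_tendsto hcont (b := 1 / 2 * lam * μ) (by
    filter_upwards [Ioo_mem_nhdsLT (zero_lt_one' ℝ)] with c hc using hle c hc)
  rw [Real.one_rpow, one_mul] at hfin
  rw [energy_eq]
  linarith

/-- Below a mass with linear level no ground state exists: raising its mass would produce
an energy strictly below the linear level. -/
lemma not_isGroundState {μ ν : ℝ} (hν : 0 < ν) (hνμ : ν < μ)
    (h : G.level p μ = 1 / 2 * lam * μ) : ¬ ∃ u, G.IsGroundState p ν u := by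
  rintro ⟨u, hu, hE⟩
  have h1 := hu.1.ratio_mul_level_lt hp2 hp6 (by rw [hu.2]; exact hν) (by rw [hu.2]; exact hνμ)
  have hμ : 0 < μ := hν.trans hνμ
  rw [hE, hG.level_eq_of_le hp2 hp6 hν.le hνμ.le h, h, hu.2] at h1
  have : ν / μ * (1 / 2 * lam * μ) = 1 / 2 * lam * ν := by field_simp
  linarith

/-- For small masses the energy per unit mass is almost `lam / 2`. -/
lemma exists_small_mass {c : ℝ} (hc : c < 1 / 2 * lam) :
    ∃ ε > 0, ∀ u, G.MemH1 u → G.mass u ≤ ε → c * G.mass u ≤ G.energy p u := by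
  set L := G.level p 1
  have hL : L ≤ 1 / 2 * lam := by simpa using hG.level_le hp2 hp6 zero_le_one
  obtain ⟨δ, hδ0, hδ1, hδ⟩ : ∃ δ : ℝ, 0 < δ ∧ δ ≤ 1 ∧ c ≤ δ * L + (1 - δ) * (1 / 2 * lam) := by
    refine ⟨min 1 ((1 / 2 * lam - c) / (1 / 2 * lam - L + 1)), ?_, min_le_left _ _, ?_⟩
    · exact lt_min one_pos (div_pos (by linarith) (by linarith))
    · have h1 := min_le_right 1 ((1 / 2 * lam - c) / (1 / 2 * lam - L + 1))
      rw [le_div_iff₀ (by linarith)] at h1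
      have h2 : 0 < min 1 ((1 / 2 * lam - c) / (1 / 2 * lam - L + 1)) :=
        lt_min one_pos (div_pos (by linarith) (by linarith))
      nlinarith
  refine ⟨(δ ^ (1 / (p - 2))) ^ 2, by positivity, fun u hu hM => ?_⟩
  rcases (mass_nonneg u).eq_or_lt with h0 | h0
  · have := kinetic_nonneg u
    rw [← h0, energy_eq, hu.power_eq_zero hp2 h0.symm]
    simp
    linarith
  set r := √(G.mass u) with hr
  have hr0 : 0 < r := Real.sqrt_pos.2 h0
  have hr2 : r ^ 2 = G.mass u := Real.sq_sqrt h0.le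
  set v : G.Edge → ℝ → ℝ := fun e x => r⁻¹ * u e x with hv
  have hv1 : v ∈ G.H1mass 1 := by
    refine ⟨hu.const_mul _, ?_⟩
    rw [hv, mass_const_mul, ← hr2]
    field_simp
  have huv : u = fun e x => r * v e x := by
    ext e x
    rw [hv]
    field_simp
  have hs : r ^ (p - 2) ≤ δ := by
    have h1 : r ≤ δ ^ (1 / (p - 2)) := by
      rw [hr]
      exact Real.sqrt_le_iff.2 ⟨by positivity, hM⟩
    calc r ^ (p - 2) ≤ (δ ^ (1 / (p - 2))) ^ (p - 2) :=
          Real.rpow_le_rpow hr0.le h1 (by linarith)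
      _ = δ := by rw [← Real.rpow_mul hδ0.le, one_div_mul_cancel (by linarith), Real.rpow_one]
  have hEv : L ≤ G.energy p v := level_le_energy hp2 hp6 hv1
  have hKv : lam ≤ G.kinetic v := by simpa [hv1.2] using hG.le v hv1.1
  have hs0 : 0 < r ^ (p - 2) := Real.rpow_pos_of_pos hr0 _
  have hEu : G.energy p u = G.mass u *
      (r ^ (p - 2) * G.energy p v + (1 - r ^ (p - 2)) * (1 / 2 * G.kinetic v)) := by
    conv_lhs => rw [huv]
    rw [energy_const_mul hr0, hr2, energy_eq]
    ring
  rw [hEu, mul_comm c]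
  refine mul_le_mul_of_nonneg_left ?_ h0.le
  have h3 : r ^ (p - 2) * L ≤ r ^ (p - 2) * G.energy p v := by gcongr
  have h4 : (1 - r ^ (p - 2)) * (1 / 2 * lam) ≤ (1 - r ^ (p - 2)) * (1 / 2 * G.kinetic v) :=
    mul_le_mul_of_nonneg_left (by linarith) (by linarith)
  nlinarith

omit hp6 in
/-- A function of energy well below the linear level is not uniformly small. -/
lemma exists_le_abs_of_energy {μ η : ℝ} (hη : 0 < η) (hμ : 0 < μ) :
    ∃ c > 0, ∀ u ∈ G.H1mass μ, G.energy p u ≤ 1 / 2 * lam * μ - η →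
      ∃ e, ∃ x ∈ Icc (0 : ℝ) 1, c ≤ |u e x| := by
  refine ⟨(η * p / (2 * μ)) ^ (1 / (p - 2)), by positivity, fun u hu hE => ?_⟩
  by_contra! hcon
  have h1 := hu.1.power_le hp2.le fun e x hx => (hcon e x hx).le
  rw [← Real.rpow_mul (by positivity), one_div_mul_cancel (by linarith), Real.rpow_one, hu.2] at h1
  have h2 := hG.le u hu.1
  rw [hu.2] at h2
  have h3 : 1 / p * G.power p u ≤ 1 / p * (η * p / (2 * μ) * μ) := by gcongr
  have h4 : 1 / p * (η * p / (2 * μ) * μ) = η / 2 := by field_simp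
  rw [energy_eq] at hE
  linarith

omit hp6 in
/-- If the sup norm is controlled by the spectral deficit `K - lam M`, then for `p ≥ 4` functions
that are small, in amplitude or in mass, have energy above the linear level. -/
lemma half_mul_mass_le_energy (hp4 : 4 ≤ p) {C c : ℝ} (hu : G.MemH1 u)
    (hC : ∀ e, ∀ x ∈ Icc (0 : ℝ) 1, u e x ^ 2 ≤ C * (G.kinetic u - lam * G.mass u))
    (hC0 : 0 ≤ C) (hc : 0 ≤ c) (hcu : ∀ e, ∀ x ∈ Icc (0 : ℝ) 1, |u e x| ≤ c)
    (hsmall : C * c ^ (p - 4) * G.mass u ≤ p / 2) :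
    1 / 2 * lam * G.mass u ≤ G.energy p u := by
  set D := G.kinetic u - lam * G.mass u with hD
  have hD0 : 0 ≤ D := by linarith [hG.le u hu]
  set S := min (√(C * D)) c
  have hS0 : 0 ≤ S := le_min (Real.sqrt_nonneg _) hc
  have h1 := hu.power_le hp2.le (S := S) fun e x hx =>
    le_min (Real.abs_le_sqrt (hC e x hx)) (hcu e x hx)
  have h2 : S ^ (p - 2) = S ^ 2 * S ^ (p - 4) := by
    rw [← Real.rpow_natCast, ← Real.rpow_add_of_nonneg hS0 (by norm_num) (by linarith)]
    congr 1; push_cast; ring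
  have h3 : S ^ 2 ≤ C * D := by
    rw [← Real.sq_sqrt (mul_nonneg hC0 hD0)]
    exact pow_le_pow_left₀ hS0 (min_le_left _ _) 2
  have h4 : S ^ (p - 4) ≤ c ^ (p - 4) := Real.rpow_le_rpow hS0 (min_le_right _ _) (by linarith)
  have hM := mass_nonneg u
  have h5 : G.power p u ≤ D * (p / 2) := by
    calc G.power p u ≤ S ^ 2 * S ^ (p - 4) * G.mass u := by rw [← h2]; exact h1
      _ ≤ C * D * c ^ (p - 4) * G.mass u := by gcongr
      _ = D * (C * c ^ (p - 4) * G.mass u) := by ring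
      _ ≤ _ := by gcongr
  have h6 : 1 / p * G.power p u ≤ 1 / p * (D * (p / 2)) := by gcongr
  have h7 : 1 / p * (D * (p / 2)) = D / 2 := by field_simp
  rw [energy_eq]
  linarith

/-- For `p ≥ 4` the level is linear for small masses. -/
lemma exists_pos_level_eq (hp4 : 4 ≤ p) {C : ℝ} (hC0 : 0 ≤ C)
    (hC : ∀ u, G.MemH1 u → ∀ e, ∀ x ∈ Icc (0 : ℝ) 1,
      u e x ^ 2 ≤ C * (G.kinetic u - lam * G.mass u)) :
    ∃ μ > 0, G.level p μ = 1 / 2 * lam * μ := by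
  obtain ⟨B, hB⟩ := exists_power_le (G := G) hp2 hp6 zero_le_one
  have hlam := hG.pos
  -- functions with a large Dirichlet integral have a large energy anyway
  set K₀ := max 0 (4 * B + 2 * lam)
  have hK₀ : 0 ≤ K₀ := le_max_left _ _
  set c := √(1 + 2 * √(1 * K₀)) with hc
  set μ := min 1 (p / 2 / (C * c ^ (p - 4) + 1)) with hμ
  have hμ0 : 0 < μ := lt_min one_pos (by positivity)
  have hμ1 : μ ≤ 1 := min_le_left _ _
  refine ⟨μ, hμ0, (hG.level_eq_iff hp2 hp6 hμ0.le).2 fun u hu => ?_⟩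
  rcases le_or_gt (G.kinetic u) K₀ with hK | hK
  · rw [← hu.2]
    refine hG.half_mul_mass_le_energy hp2 hp4 hu.1 (hC u hu.1) hC0 (Real.sqrt_nonneg _)
      (c := c) (fun e x hx => (hu.1.abs_le e hx).trans (Real.sqrt_le_sqrt ?_)) ?_
    · have := kinetic_nonneg u
      rw [hu.2]; gcongr
    · have h1 : μ ≤ p / 2 / (C * c ^ (p - 4) + 1) := min_le_right _ _
      rw [le_div_iff₀ (by positivity)] at h1
      rw [hu.2]
      nlinarith
  · have h1 := hB u hu.1 (hu.2.le.trans hμ1)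
    have h2 : 4 * B + 2 * lam < G.kinetic u := (le_max_right _ _).trans_lt hK
    rw [energy_eq]
    nlinarith

end SpectralGap

end UnitMetricGraph

open Filter Topology

/-! ### Limits along an ultrafilter -/

/-- Bounded sequences in a Hilbert space converge weakly along every ultrafilter. -/
lemma exists_weak_limit {ι H : Type*} [NormedAddCommGroup H] [InnerProductSpace ℝ H]
    [CompleteSpace H] (U : Ultrafilter ι) {v : ι → H} {C : ℝ} (hv : ∀ n, ‖v n‖ ≤ C) :
    ∃ w : H, ∀ h : H, Tendsto (fun n => inner ℝ (v n) h) U (𝓝 (inner ℝ w h)) := by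
  set F : ι → WeakDual ℝ H := fun n => StrongDual.toWeakDual (InnerProductSpace.toDual ℝ H (v n))
  have hK := WeakDual.isCompact_closedBall (𝕜 := ℝ) (E := H) 0 C
  obtain ⟨φ, -, hφ⟩ := hK.ultrafilter_le_nhds (U.map F) (by
    rw [le_principal_iff]
    refine mem_map.2 (univ_mem' fun n => ?_)
    simpa [F] using hv n)
  refine ⟨(InnerProductSpace.toDual ℝ H).symm (WeakDual.toStrongDual φ), fun h => ?_⟩
  have h1 : Tendsto F U (𝓝 φ) := hφ
  have h2 := ((WeakDual.eval_continuous h).tendsto φ).comp h1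
  simpa [F, Function.comp_def] using h2

lemma exists_real_limit {ι : Type*} (U : Ultrafilter ι) {c : ι → ℝ} {C : ℝ}
    (hc : ∀ n, |c n| ≤ C) : ∃ a, Tendsto c U (𝓝 a) := by
  obtain ⟨a, -, ha⟩ := (isCompact_Icc (a := -C) (b := C)).ultrafilter_le_nhds (U.map c) (by
    rw [le_principal_iff]
    exact mem_map.2 (univ_mem' fun n => _root_.abs_le.1 (hc n)))
  exact ⟨a, ha⟩

/-- Pointwise convergence to zero of functions bounded in `H¹(0, 1)` is uniform. -/
lemma eventually_abs_le_of_tendsto {ι : Type*} {l : Filter ι} {h : ι → ℝ → ℝ} {C : ℝ}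
    (hh : ∀ n, EdgeH1 (h n)) (hC : ∀ n, edgeKin (h n) ≤ C)
    (hlim : ∀ x ∈ Icc (0 : ℝ) 1, Tendsto (fun n => h n x) l (𝓝 0)) {ε : ℝ} (hε : 0 < ε) :
    ∀ᶠ n in l, ∀ x ∈ Icc (0 : ℝ) 1, |h n x| ≤ ε := by
  obtain ⟨N, hN⟩ := exists_nat_gt (C / (ε / 2) ^ 2)
  -- it is enough to control `h` on the grid of mesh `1 / (N + 1)`
  set M : ℝ := (N : ℝ) + 1 with hM
  have hM0 : 0 < M := by positivity
  have hCM : C / M ≤ (ε / 2) ^ 2 := by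
    rw [div_lt_iff₀ (by positivity)] at hN
    rw [div_le_iff₀ hM0]
    nlinarith [sq_nonneg (ε / 2)]
  have hgrid : ∀ᶠ n in l, ∀ j ∈ Finset.range (N + 2), |h n (j / M)| ≤ ε / 2 := by
    rw [eventually_all_finset]
    intro j hj
    have hj' : (j : ℝ) ≤ M := by
      have : j ≤ N + 1 := by simpa [Nat.lt_succ_iff] using hj
      rw [hM]; exact_mod_cast this
    have := (hlim (j / M) ⟨by positivity, (div_le_one hM0).2 hj'⟩).abs
    rw [abs_zero] at this
    exact this.eventually_le_const (by linarith)
  filter_upwards [hgrid] with n hn x hx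
  set j := ⌊x * M⌋₊ with hj
  have hxM : 0 ≤ x * M := mul_nonneg hx.1 hM0.le
  have h1 : (j : ℝ) ≤ x * M := Nat.floor_le hxM
  have h2 : x * M < j + 1 := Nat.lt_floor_add_one _
  have h3 : (j : ℝ) / M ≤ x := (div_le_iff₀ hM0).2 h1
  have h4 : x - j / M ≤ 1 / M := by
    rw [sub_le_iff_le_add, ← add_div, le_div_iff₀ hM0]; linarith
  have hjN : j ∈ Finset.range (N + 2) := by
    rw [Finset.mem_range]
    have : (j : ℝ) ≤ N + 1 := h1.trans (by nlinarith [hx.2])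
    have : j ≤ N + 1 := by exact_mod_cast this
    omega
  have h5 := (hh n).sq_sub_le (x := j / M) (y := x) ⟨by positivity, h3.trans hx.2⟩ hx
  rw [abs_of_nonneg (by linarith)] at h5
  have h6 : (h n x - h n (j / M)) ^ 2 ≤ (ε / 2) ^ 2 := by
    have hC0 := edgeKin_nonneg (h n)
    calc _ ≤ _ := h5
      _ ≤ 1 / M * C := mul_le_mul h4 (hC n) hC0 (by positivity)
      _ = C / M := by ring
      _ ≤ _ := hCM
  have h7 := abs_le_of_sq_le_sq h6 (by positivity)
  have h8 := hn j hjN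
  have h9 := abs_sub_abs_le_abs_sub (h n x) (h n (j / M))
  linarith

/-- Weak compactness in `H¹(0, 1)`. -/
lemma exists_edge_limit {ι : Type*} (U : Ultrafilter ι) {f : ι → ℝ → ℝ} {C : ℝ}
    (hf : ∀ n, EdgeH1 (f n)) (hK : ∀ n, edgeKin (f n) ≤ C) (h0 : ∀ n, |f n 0| ≤ C) :
    ∃ g, EdgeH1 g ∧
      (∀ ε > 0, ∀ᶠ n in (U : Filter ι), ∀ x ∈ Icc (0 : ℝ) 1, |f n x - g x| ≤ ε) ∧
      Tendsto (fun n => ∫ x in Icc (0 : ℝ) 1, deriv g x * deriv (fun y => f n y - g y) x)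
        U (𝓝 0) := by
  set ν := volume.restrict (Icc (0 : ℝ) 1) with hν
  set v : ι → Lp ℝ 2 ν := fun n => (hf n).memLp_deriv.toLp (deriv (f n)) with hv
  have hvn : ∀ n, ‖v n‖ ≤ √C := by
    intro n
    refine Real.le_sqrt_of_sq_le ?_
    rw [← real_inner_self_eq_norm_sq, L2.inner_def]
    refine le_trans (le_of_eq ?_) (hK n)
    refine integral_congr_ae ?_
    filter_upwards [(hf n).memLp_deriv.coeFn_toLp] with x hx
    simp [v, hx, sq]
  obtain ⟨w, hw⟩ := exists_weak_limit U hvn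
  obtain ⟨c, hc⟩ := exists_real_limit U h0
  obtain ⟨hg, hgd⟩ := EdgeH1.of_integral (f := fun x => c + ∫ t in (0 : ℝ)..x, w t)
    (g := w) (c := c) (Lp.memLp w) fun x _ => rfl
  set g : ℝ → ℝ := fun x => c + ∫ t in (0 : ℝ)..x, w t with hgdef
  have hpt : ∀ x ∈ Icc (0 : ℝ) 1, Tendsto (fun n => f n x) U (𝓝 (g x)) := by
    intro x hx
    have hsub : Ioc 0 x ⊆ Icc 0 1 := fun t ht => ⟨ht.1.le, ht.2.trans hx.2⟩
    have hfin : ν (Ioc 0 x) ≠ ⊤ := measure_ne_top _ _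
    have key : ∀ F : Lp ℝ 2 ν, inner ℝ F (indicatorConstLp 2 measurableSet_Ioc hfin (1 : ℝ))
        = ∫ t in (0 : ℝ)..x, F t := by
      intro F
      have hr : ν.restrict (Ioc 0 x) = volume.restrict (Ioc 0 x) := by
        rw [hν, Measure.restrict_restrict measurableSet_Ioc, inter_eq_self_of_subset_left hsub]
      rw [real_inner_comm, L2.inner_indicatorConstLp_one, intervalIntegral.integral_of_le hx.1]
      exact congrArg (fun κ : Measure ℝ => ∫ t, F t ∂κ) hr
    have h1 := hw (indicatorConstLp 2 measurableSet_Ioc hfin (1 : ℝ))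
    simp_rw [key] at h1
    have h2 : ∀ n, f n x = f n 0 + ∫ t in (0 : ℝ)..x, v n t := by
      intro n
      have h3 := (hf n).sub_eq_integral (x := 0) (y := x) (by simp) hx
      have h4 : ∫ t in (0 : ℝ)..x, v n t = ∫ t in (0 : ℝ)..x, deriv (f n) t := by
        rw [intervalIntegral.integral_of_le hx.1, intervalIntegral.integral_of_le hx.1]
        exact integral_congr_ae (ae_restrict_of_ae_restrict_of_subset hsub
          (hf n).memLp_deriv.coeFn_toLp)
      rw [h4, ← h3]; ring
    simp_rw [h2]
    exact hc.add h1
  refine ⟨g, hg, fun ε hε => ?_, ?_⟩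
  · refine eventually_abs_le_of_tendsto (h := fun n x => f n x - g x)
      (C := 2 * C + 2 * edgeKin g) (fun n => (hf n).sub hg)
      (fun n => ((hf n).edgeKin_sub_le hg).trans (by linarith [hK n])) (fun x hx => ?_) hε
    simpa using (hpt x hx).sub_const (g x)
  · have h1 : ∀ n, ∫ x in Icc (0 : ℝ) 1, deriv g x * deriv (fun y => f n y - g y) x
        = inner ℝ (v n) w - inner ℝ w w := by
      intro n
      rw [← inner_sub_left, L2.inner_def]
      refine integral_congr_ae ?_
      filter_upwards [(hf n).memLp_deriv.coeFn_toLp, hgd, (hf n).ae_deriv_sub hg,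
        Lp.coeFn_sub (v n) w] with x hx1 hx2 hx3 hx4
      rw [hx4, hx3, hx2]
      simp [v, hx1]
    refine Tendsto.congr (fun n => (h1 n).symm) ?_
    simpa using (hw w).sub_const (inner ℝ w w)

/-- Convergence to zero of the sums of cross terms `c n e` between a fixed summable `b` and a bounded
family of sums of `a n`, from termwise convergence. Cross terms are recognised by the inequality of
the means `|c n e| ≤ η a n e + η⁻¹ b e`, which is dominated convergence up to the small part `η a`. -/
lemma tendsto_hasSum_zero {ι E : Type*} {l : Filter ι} {c a : ι → E → ℝ} {b : E → ℝ}
    {s t : ι → ℝ} {A : ℝ} (hb : Summable b) (hb0 : ∀ e, 0 ≤ b e)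
    (ha0 : ∀ n e, 0 ≤ a n e) (ha : ∀ n, HasSum (a n) (t n))
    (hA : ∀ n, t n ≤ A) (hc : ∀ e, Tendsto (fun n => c n e) l (𝓝 0))
    (hcs : ∀ n, HasSum (c n) (s n))
    (hbound : ∀ η > 0, ∀ n e, |c n e| ≤ η * a n e + η⁻¹ * b e) : Tendsto s l (𝓝 0) := by
  rw [Metric.tendsto_nhds]
  intro ε hε
  rcases isEmpty_or_nonempty ι with hι | ⟨⟨n₀⟩⟩
  · exact Eventually.of_forall fun n => (hι.false n).elim
  have hA0 : 0 ≤ A := ((ha n₀).nonneg (ha0 n₀)).trans (hA n₀)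
  set η := ε / (2 * (A + 1)) with hη
  have hη0 : 0 < η := by positivity
  set d : ι → E → ℝ := fun n e => max (|c n e| - η * a n e) 0 with hd
  have hd0 : ∀ n e, 0 ≤ d n e := fun n e => le_max_right _ _
  have hdb : ∀ n e, d n e ≤ η⁻¹ * b e := fun n e => max_le
    (by linarith [hbound η hη0 n e]) (mul_nonneg (inv_nonneg.2 hη0.le) (hb0 e))
  have hdsum : ∀ n, Summable (d n) := fun n =>
    Summable.of_nonneg_of_le (hd0 n) (hdb n) (hb.mul_left _)
  have hdt : Tendsto (fun n => ∑' e, d n e) l (𝓝 (∑' _ : E, 0)) := by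
    refine tendsto_tsum_of_dominated_convergence (hb.mul_left η⁻¹) (fun e => ?_)
      (Eventually.of_forall fun n e => by
        rw [Real.norm_eq_abs, abs_of_nonneg (hd0 n e)]; exact hdb n e)
    have h1 := (hc e).abs
    rw [abs_zero] at h1
    refine squeeze_zero (fun n => hd0 n e) (fun n => max_le ?_ (abs_nonneg _)) h1
    have := mul_nonneg hη0.le (ha0 n e)
    linarith
  rw [tsum_zero] at hdt
  filter_upwards [hdt.eventually_lt_const (show (0 : ℝ) < ε / 2 by linarith)] with n hn
  have h1 : ∀ e, |c n e| ≤ d n e + η * a n e := fun e => by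
    have := le_max_left (|c n e| - η * a n e) 0
    simp only [hd]; linarith
  have h2 : HasSum (fun e => d n e + η * a n e) (∑' e, d n e + η * t n) :=
    (hdsum n).hasSum.add ((ha n).mul_left η)
  have h3 : |s n| ≤ ∑' e, d n e + η * t n := by
    refine abs_le.2 ⟨?_, hasSum_le (fun e => (le_abs_self _).trans (h1 e)) (hcs n) h2⟩
    exact neg_le.1 (hasSum_le (fun e => (neg_le_abs _).trans (h1 e)) (hcs n).neg h2)
  have h4 : η * t n ≤ ε / 2 := by
    calc η * t n ≤ η * (A + 1) := by gcongr; linarith [hA n]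
      _ = ε / 2 := by rw [hη]; field_simp
  rw [Real.dist_eq, sub_zero]
  linarith

/-- Fatou's lemma for sums in the form adapted to weak limits. -/
lemma summable_of_tendsto_sub {ι E : Type*} {l : Filter ι} [l.NeBot] {a d : ι → E → ℝ} {b : E → ℝ}
    {t : ι → ℝ} {A : ℝ} (hb : ∀ e, 0 ≤ b e) (ha0 : ∀ n e, 0 ≤ a n e) (hd0 : ∀ n e, 0 ≤ d n e)
    (ha : ∀ n, HasSum (a n) (t n)) (hA : ∀ n, t n ≤ A)
    (hc : ∀ e, Tendsto (fun n => a n e - b e - d n e) l (𝓝 0)) : Summable b := by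
  refine summable_of_sum_le (c := A) hb fun s => ?_
  have h1 : Tendsto (fun n => ∑ e ∈ s, (a n e - b e - d n e)) l (𝓝 (∑ _ ∈ s, 0)) :=
    tendsto_finsetSum _ fun e _ => hc e
  have h2 : Tendsto (fun n => ∑ e ∈ s, (a n e - b e - d n e) + ∑ e ∈ s, b e) l
      (𝓝 (0 + ∑ e ∈ s, b e)) := by
    simpa using h1.add_const (∑ e ∈ s, b e)
  rw [zero_add] at h2
  refine le_of_tendsto h2 (Eventually.of_forall fun n => ?_)
  have h3 : ∑ e ∈ s, a n e ≤ A := (sum_le_hasSum s (fun e _ => ha0 n e) (ha n)).trans (hA n)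
  have h4 : 0 ≤ ∑ e ∈ s, d n e := Finset.sum_nonneg fun e _ => hd0 n e
  rw [Finset.sum_sub_distrib, Finset.sum_sub_distrib]
  linarith

/-! ### Compactness of almost minimizing sequences -/

/-- The Cauchy–Schwarz inequality in additive form, which can be summed over the edges. -/
lemma abs_integral_mul_le {F H : ℝ → ℝ} {ν : Measure ℝ} (hF : Integrable (fun x => |F x| ^ 2) ν)
    (hH : Integrable (fun x => |H x| ^ 2) ν) (hFH : Integrable (fun x => F x * H x) ν) {η : ℝ}
    (hη : 0 < η) :
    ∫ x, |F x * H x| ∂ν ≤ η * ∫ x, |H x| ^ 2 ∂ν + η⁻¹ * ∫ x, |F x| ^ 2 ∂ν := by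
  rw [← integral_const_mul, ← integral_const_mul, ← integral_add (hH.const_mul _) (hF.const_mul _)]
  refine integral_mono hFH.abs ((hH.const_mul _).add (hF.const_mul _)) fun x => ?_
  simp only [abs_mul]
  have h1 : 0 < η⁻¹ := inv_pos.2 hη
  have h2 : η * η⁻¹ = 1 := mul_inv_cancel₀ hη.ne'
  have h3 : 0 ≤ η⁻¹ * (|F x| - η * |H x|) ^ 2 := by positivity
  have h4 : η⁻¹ * (|F x| - η * |H x|) ^ 2
      = η⁻¹ * |F x| ^ 2 - 2 * (|F x| * |H x|) * (η * η⁻¹) + η * |H x| ^ 2 * (η * η⁻¹) := by ring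
  rw [h4, h2] at h3
  nlinarith [mul_nonneg (abs_nonneg (F x)) (abs_nonneg (H x))]

namespace UnitMetricGraph

variable {G : UnitMetricGraph} {p lam : ℝ}

/-- A bounded family in `H¹(G)` converges along an ultrafilter, uniformly on each edge, and mass,
Dirichlet integral and nonlinear term split asymptotically into those of the limit and of the
remainder (the Brezis–Lieb property). -/
lemma exists_limit {ι : Type*} (U : Ultrafilter ι) (hp2 : 2 < p) {u : ι → G.Edge → ℝ → ℝ}
    {A : ℝ} (hu : ∀ n, G.MemH1 (u n)) (hM : ∀ n, G.mass (u n) ≤ A)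
    (hK : ∀ n, G.kinetic (u n) ≤ A) :
    ∃ v, G.MemH1 v ∧
      (∀ e, ∀ ε > 0, ∀ᶠ n in (U : Filter ι), ∀ x ∈ Icc (0 : ℝ) 1, |u n e x - v e x| ≤ ε) ∧
      Tendsto (fun n => G.mass (u n) - G.mass v - G.mass fun e x => u n e x - v e x) U (𝓝 0) ∧
      Tendsto (fun n => G.kinetic (u n) - G.kinetic v - G.kinetic fun e x => u n e x - v e x)
        U (𝓝 0) ∧
      Tendsto (fun n => G.power p (u n) - G.power p v - G.power p fun e x => u n e x - v e x)
        U (𝓝 0) := by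
  obtain ⟨n₀⟩ : Nonempty ι := U.neBot.nonempty
  have hA : 0 ≤ A := (mass_nonneg _).trans (hM n₀)
  -- a common bound for the sup norms
  set S : ℝ := √(A + 2 * √(A * A)) with hS
  have hsup : ∀ n e, ∀ x ∈ Icc (0 : ℝ) 1, |u n e x| ≤ S := by
    intro n e x hx
    refine ((hu n).abs_le e hx).trans (Real.sqrt_le_sqrt ?_)
    have := mul_le_mul (hM n) (hK n) (kinetic_nonneg _) hA
    gcongr
    exact hM n
  choose v hv hunif hcross using fun e => exists_edge_limit U (f := fun n => u n e)
    (C := max A S) (fun n => (hu n).edge e)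
    (fun n => (((hu n).edgeKin_le_kinetic e).trans (hK n)).trans (le_max_left _ _))
    (fun n => (hsup n e 0 (by simp)).trans (le_max_right _ _))
  have hpt : ∀ e, ∀ x ∈ Icc (0 : ℝ) 1, Tendsto (fun n => u n e x) U (𝓝 (v e x)) := by
    intro e x hx
    rw [Metric.tendsto_nhds]
    intro ε hε
    filter_upwards [hunif e (ε / 2) (by linarith)] with n hn
    rw [Real.dist_eq]
    linarith [hn x hx]
  have hvS : ∀ e, ∀ x ∈ Icc (0 : ℝ) 1, |v e x| ≤ S := fun e x hx =>
    le_of_tendsto (hpt e x hx).abs (Eventually.of_forall fun n => hsup n e x hx)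
  have hw : ∀ n e, EdgeH1 fun x => u n e x - v e x := fun n e => ((hu n).edge e).sub (hv e)
  -- the cross terms vanish on every edge
  have hc0 : ∀ e, Tendsto (fun n => ∫ x in Icc (0 : ℝ) 1, |v e x * (u n e x - v e x)|) U
      (𝓝 0) := by
    intro e
    rw [Metric.tendsto_nhds]
    intro ε hε
    have hS0 : 0 ≤ S := Real.sqrt_nonneg _
    filter_upwards [hunif e (ε / (2 * (S + 1))) (by positivity)] with n hn
    have h1 : ∫ x in Icc (0 : ℝ) 1, |v e x * (u n e x - v e x)| ≤
        ∫ _ in Icc (0 : ℝ) 1, ε / 2 := by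
      refine setIntegral_mono_on ((hv e).integrable_mul (hw n e)).abs (integrable_const _)
        measurableSet_Icc fun x hx => ?_
      rw [abs_mul]
      calc _ ≤ (S + 1) * (ε / (2 * (S + 1))) :=
            mul_le_mul ((hvS e x hx).trans (by linarith)) (hn x hx) (abs_nonneg _) (by linarith)
        _ = ε / 2 := by field_simp
    have h2 : 0 ≤ ∫ x in Icc (0 : ℝ) 1, |v e x * (u n e x - v e x)| :=
      integral_nonneg fun _ => abs_nonneg _
    simp only [integral_const, MeasurableSet.univ, measureReal_restrict_apply, univ_inter,
      Real.volume_real_Icc, sub_zero, zero_le_one, max_eq_left, smul_eq_mul, one_mul] at h1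
    rw [Real.dist_eq, sub_zero, abs_of_nonneg h2]
    linarith
  have hcM : ∀ e, Tendsto (fun n => edgeMass (u n e) - edgeMass (v e)
      - edgeMass fun x => u n e x - v e x) U (𝓝 0) := by
    intro e
    have h0 := (hc0 e).const_mul 2
    rw [mul_zero] at h0
    refine squeeze_zero_norm (fun n => ?_) h0
    rw [((hu n).edge e).edgeMass_sub_split (hv e), Real.norm_eq_abs, abs_mul, abs_two]
    exact mul_le_mul_of_nonneg_left abs_integral_le_integral_abs zero_le_two
  have hcK : ∀ e, Tendsto (fun n => edgeKin (u n e) - edgeKin (v e)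
      - edgeKin fun x => u n e x - v e x) U (𝓝 0) := by
    intro e
    have := (hcross e).const_mul 2
    rw [mul_zero] at this
    exact this.congr fun n => (((hu n).edge e).edgeKin_sub_split (hv e)).symm
  have hvH : G.MemH1 v := by
    refine memH1_iff.2 ⟨?_, hv,
      summable_of_tendsto_sub (fun _ => edgeMass_nonneg _) (fun _ _ => edgeMass_nonneg _)
        (fun _ _ => edgeMass_nonneg _) (fun n => (hu n).hasSum_mass) hM hcM,
      summable_of_tendsto_sub (fun _ => edgeKin_nonneg _) (fun _ _ => edgeKin_nonneg _)
        (fun _ _ => edgeKin_nonneg _) (fun n => (hu n).hasSum_kinetic) hK hcK⟩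
    choose φ hφ using fun n => (hu n).continuous_vertex
    refine ⟨fun y => limUnder (U : Filter ι) fun n => φ n y, fun e => ⟨?_, ?_⟩⟩
    · have h := hpt e 0 (by simp)
      simp_rw [(hφ _ e).1] at h
      exact h.limUnder_eq.symm
    · have h := hpt e 1 (by simp)
      simp_rw [(hφ _ e).2] at h
      exact h.limUnder_eq.symm
  have hwH : ∀ n, G.MemH1 fun e x => u n e x - v e x := fun n => (hu n).sub hvH
  -- bounds for the remainders
  have hMw : ∀ n, G.mass (fun e x => u n e x - v e x) ≤ 2 * A + 2 * G.mass v := fun n => by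
    refine (hasSum_le (fun e => ((hu n).edge e).edgeMass_sub_le (hv e)) (hwH n).hasSum_mass
      (((hu n).hasSum_mass.mul_left 2).add (hvH.hasSum_mass.mul_left 2))).trans ?_
    linarith [hM n]
  have hKw : ∀ n, G.kinetic (fun e x => u n e x - v e x) ≤ 2 * A + 2 * G.kinetic v := fun n => by
    refine (hasSum_le (fun e => ((hu n).edge e).edgeKin_sub_le (hv e)) (hwH n).hasSum_kinetic
      (((hu n).hasSum_kinetic.mul_left 2).add (hvH.hasSum_kinetic.mul_left 2))).trans ?_
    linarith [hK n]
  have hbnd : ∀ η > 0, ∀ n e, ∫ x in Icc (0 : ℝ) 1, |v e x * (u n e x - v e x)|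
      ≤ η * edgeMass (fun x => u n e x - v e x) + η⁻¹ * edgeMass (v e) := fun η hη n e =>
    abs_integral_mul_le (hv e).integrable_sq (hw n e).integrable_sq
      ((hv e).integrable_mul (hw n e)) hη
  have hbndK : ∀ η > 0, ∀ n e,
      |∫ x in Icc (0 : ℝ) 1, deriv (v e) x * deriv (fun y => u n e y - v e y) x|
      ≤ η * edgeKin (fun x => u n e x - v e x) + η⁻¹ * edgeKin (v e) := fun η hη n e =>
    abs_integral_le_integral_abs.trans (abs_integral_mul_le (hv e).integrable_deriv_sq
      (hw n e).integrable_deriv_sq ((hv e).integrable_deriv_mul (hw n e)) hη)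
  refine ⟨v, hvH, hunif, ?_, ?_, ?_⟩
  · refine tendsto_hasSum_zero (a := fun n e => 2 * edgeMass fun x => u n e x - v e x)
      (b := fun e => 2 * edgeMass (v e)) (hvH.hasSum_mass.summable.mul_left 2)
      (fun e => by have := edgeMass_nonneg (v e); positivity)
      (fun n e => by have := edgeMass_nonneg fun x => u n e x - v e x; positivity)
      (fun n => (hwH n).hasSum_mass.mul_left 2)
      (fun n => mul_le_mul_of_nonneg_left (hMw n) zero_le_two) hcM
      (fun n => ((hu n).hasSum_mass.sub hvH.hasSum_mass).sub (hwH n).hasSum_mass) ?_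
    intro η hη n e
    rw [((hu n).edge e).edgeMass_sub_split (hv e), abs_mul, abs_two]
    have h1 := hbnd η hη n e
    have h2 := abs_integral_le_integral_abs (μ := volume.restrict (Icc (0 : ℝ) 1))
      (f := fun x => v e x * (u n e x - v e x))
    linarith
  · refine tendsto_hasSum_zero (a := fun n e => 2 * edgeKin fun x => u n e x - v e x)
      (b := fun e => 2 * edgeKin (v e)) (hvH.hasSum_kinetic.summable.mul_left 2)
      (fun e => by have := edgeKin_nonneg (v e); positivity)
      (fun n e => by have := edgeKin_nonneg fun x => u n e x - v e x; positivity)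
      (fun n => (hwH n).hasSum_kinetic.mul_left 2)
      (fun n => mul_le_mul_of_nonneg_left (hKw n) zero_le_two) hcK
      (fun n => ((hu n).hasSum_kinetic.sub hvH.hasSum_kinetic).sub (hwH n).hasSum_kinetic) ?_
    intro η hη n e
    rw [((hu n).edge e).edgeKin_sub_split (hv e), abs_mul, abs_two]
    have h1 := hbndK η hη n e
    linarith
  · set C : ℝ := p * 2 ^ p * (2 * S) ^ (p - 2) with hC
    have hS0 : 0 ≤ S := Real.sqrt_nonneg _
    have hC0 : 0 ≤ C := by positivity
    have hcP : ∀ n e, |edgePow p (u n e) - edgePow p (v e) - edgePow p fun x => u n e x - v e x|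
        ≤ C * ∫ x in Icc (0 : ℝ) 1, |v e x * (u n e x - v e x)| := fun n e =>
      ((hu n).edge e).abs_edgePow_sub_split_le (hv e) hp2.le
        (fun x hx => (abs_sub _ _).trans (by linarith [hsup n e x hx, hvS e x hx]))
        (fun x hx => (hvS e x hx).trans (by linarith))
    refine tendsto_hasSum_zero (a := fun n e => C * edgeMass fun x => u n e x - v e x)
      (b := fun e => C * edgeMass (v e)) (hvH.hasSum_mass.summable.mul_left C)
      (fun e => by have := edgeMass_nonneg (v e); positivity)
      (fun n e => by have := edgeMass_nonneg fun x => u n e x - v e x; positivity)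
      (fun n => (hwH n).hasSum_mass.mul_left C)
      (fun n => mul_le_mul_of_nonneg_left (hMw n) hC0)
      (fun e => squeeze_zero_norm (fun n => hcP n e) (by simpa using (hc0 e).const_mul C))
      (fun n => (((hu n).hasSum_power hp2.le).sub (hvH.hasSum_power hp2.le)).sub
        ((hwH n).hasSum_power hp2.le)) ?_
    intro η hη n e
    refine (hcP n e).trans ((mul_le_mul_of_nonneg_left (hbnd η hη n e) hC0).trans_eq ?_)
    ring

/-- If functions of mass close to `μ` and energy close to `ℓ ≤ level μ` can be found which do not
vanish on a fixed edge, then some function of mass `μ` has energy at most `ℓ`. No mass is lost in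
the limit, because the energy per unit mass strictly decreases when the mass grows. -/
theorem exists_energy_le_of_not_vanishing (hp2 : 2 < p) (hp6 : p < 6) {μ ℓ c : ℝ} (hμ : 0 < μ)
    (hℓ : ℓ ≤ G.level p μ) (hc : 0 < c) (e : G.Edge)
    (H : ∀ ε > 0, ∃ u, G.MemH1 u ∧ |G.mass u - μ| ≤ ε ∧ G.energy p u ≤ ℓ + ε ∧
      ∃ x ∈ Icc (0 : ℝ) 1, c ≤ |u e x|) :
    ∃ v ∈ G.H1mass μ, G.energy p v ≤ ℓ := by
  choose u hu huM huE hux using fun n : ℕ => H (1 / ((n : ℝ) + 1)) (by positivity)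
  have hn1 : ∀ n : ℕ, 1 / ((n : ℝ) + 1) ≤ 1 := fun n => by
    rw [div_le_one (by positivity)]
    linarith [(Nat.cast_nonneg n : (0 : ℝ) ≤ n)]
  have hM : ∀ n, G.mass (u n) ≤ μ + 1 := fun n => by
    linarith [le_abs_self (G.mass (u n) - μ), huM n, hn1 n]
  obtain ⟨B, hB⟩ := exists_power_le (G := G) hp2 hp6 (by linarith : 0 ≤ μ + 1)
  have hK : ∀ n, G.kinetic (u n) ≤ 4 * (|ℓ| + 1 + B) := fun n => by
    have h1 := hB (u n) (hu n) (hM n)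
    have h2 := huE n
    rw [energy_eq] at h2
    linarith [hn1 n, le_abs_self ℓ]
  set U : Ultrafilter ℕ := hyperfilter ℕ with hU
  have hUtop : (U : Filter ℕ) ≤ atTop := by
    rw [← Nat.cofinite_eq_atTop]; exact hyperfilter_le_cofinite
  obtain ⟨v, hv, hunif, hsM, hsK, hsP⟩ := exists_limit (p := p) U hp2
    (A := max (μ + 1) (4 * (|ℓ| + 1 + B))) hu (fun n => (hM n).trans (le_max_left _ _))
    (fun n => (hK n).trans (le_max_right _ _))
  have hlim0 : Tendsto (fun n : ℕ => 1 / ((n : ℝ) + 1)) U (𝓝 0) :=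
    tendsto_one_div_add_atTop_nhds_zero_nat.mono_left hUtop
  have hMlim : Tendsto (fun n => G.mass (u n)) U (𝓝 μ) := by
    have := squeeze_zero_norm (f := fun n => G.mass (u n) - μ) huM hlim0
    simpa using this.add_const μ
  -- the limit does not vanish
  have hv0 : 0 < G.mass v := by
    obtain ⟨n, hn⟩ := (hunif e (c / 2) (by linarith)).exists
    obtain ⟨x, hx, hcx⟩ := hux n
    have h1 : v e x ≠ 0 := by
      intro h0
      have := hn x hx
      rw [h0, sub_zero] at this
      linarith
    exact ((hv.edge e).edgeMass_pos hx h1).trans_le (hv.edgeMass_le_mass e)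
  set w : ℕ → G.Edge → ℝ → ℝ := fun n e x => u n e x - v e x with hw
  have hwM : Tendsto (fun n => G.mass (w n)) U (𝓝 (μ - G.mass v)) := by
    have := (hMlim.sub_const (G.mass v)).sub hsM
    rw [sub_zero] at this
    exact this.congr fun n => by ring
  have hmμ : G.mass v ≤ μ := by
    have := ge_of_tendsto' hwM fun n => mass_nonneg (w n)
    linarith
  have hE : Tendsto (fun n => G.energy p (u n) - G.energy p v - G.energy p (w n)) U (𝓝 0) := by
    have := (hsK.const_mul (1 / 2)).sub (hsP.const_mul (1 / p))
    rw [mul_zero, mul_zero, sub_zero] at this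
    refine this.congr fun n => ?_
    simp only [energy_eq, hw]
    ring
  -- the remainder pays at least its share of the level
  have hEw : ∀ᶠ n in (U : Filter ℕ), G.mass (w n) / μ * ℓ ≤ G.energy p (w n) := by
    filter_upwards [hwM.eventually_le_const (show μ - G.mass v < μ by linarith)] with n hn
    refine le_trans ?_ (((hu n).sub hv).ratio_mul_level_le hp2 hp6 hμ hn)
    have := mass_nonneg (w n)
    gcongr
  have hfin : G.energy p v ≤ G.mass v / μ * ℓ := by
    have h1 : Tendsto (fun n : ℕ => ℓ + 1 / ((n : ℝ) + 1)
        - (G.energy p (u n) - G.energy p v - G.energy p (w n)) - G.mass (w n) / μ * ℓ) U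
        (𝓝 (ℓ + 0 - 0 - (μ - G.mass v) / μ * ℓ)) :=
      ((tendsto_const_nhds.add hlim0).sub hE).sub ((hwM.div_const μ).mul_const ℓ)
    have h2 : ℓ + 0 - 0 - (μ - G.mass v) / μ * ℓ = G.mass v / μ * ℓ := by
      field_simp; ring
    rw [h2] at h1
    refine ge_of_tendsto h1 ?_
    filter_upwards [hEw] with n hn
    linarith [huE n]
  rcases hmμ.lt_or_eq with hlt | heq
  · have h1 := hv.ratio_mul_level_lt hp2 hp6 hv0 hlt
    have h2 : G.mass v / μ * ℓ ≤ G.mass v / μ * G.level p μ := by gcongr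
    linarith
  · refine ⟨v, ⟨hv, heq⟩, ?_⟩
    rwa [heq, div_self hμ.ne', one_mul] at hfin

end UnitMetricGraph

/-! ### Functions on a binary branch -/

/-- A binary word is empty, or is obtained by adding a last letter to another word. -/
def wordSnocEquiv : Option (Bool × List Bool) ≃ List Bool where
  toFun o := o.elim [] fun q => q.2 ++ [q.1]
  invFun w := match w.reverse with
    | [] => none
    | b :: t => some (b, t.reverse)
  left_inv o := by rcases o with _ | ⟨b, w⟩ <;> simp
  right_inv w := by
    induction w using List.reverseRecOn with
    | nil => rfl
    | append_singleton w b => simp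

/-- A binary word is empty, or is obtained by adding a first letter to another word. -/
def wordConsEquiv : Option (Bool × List Bool) ≃ List Bool where
  toFun o := o.elim [] fun q => q.1 :: q.2
  invFun w := match w with
    | [] => none
    | b :: t => some (b, t)
  left_inv o := by rcases o with _ | ⟨b, w⟩ <;> rfl
  right_inv w := by cases w <;> rfl

lemma hasSum_option_bool_prod {E : Type*} {F : Option (Bool × E) → ℝ} {s t : ℝ}
    (hs : HasSum (fun w => F (some (false, w))) s) (ht : HasSum (fun w => F (some (true, w))) t) :
    HasSum F (F none + (s + t)) := by
  have h1 : HasSum (fun q : Bool × E => F (some q)) (s + t) := by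
    rw [← (Equiv.boolProdEquivSum E).symm.hasSum_iff]
    exact HasSum.sum (f := (fun q : Bool × E => F (some q)) ∘ (Equiv.boolProdEquivSum E).symm) hs ht
  rw [← (Equiv.optionEquivSumPUnit.{0} (Bool × E)).symm.hasSum_iff, add_comm]
  refine HasSum.sum (f := F ∘ (Equiv.optionEquivSumPUnit.{0} (Bool × E)).symm) h1 ?_
  exact hasSum_unique (fun _ : PUnit.{1} => F none)

lemma hasSum_words_snoc {F : List Bool → ℝ} {s t : ℝ}
    (hs : HasSum (fun w => F (w ++ [false])) s) (ht : HasSum (fun w => F (w ++ [true])) t) :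
    HasSum F (F [] + (s + t)) := by
  rw [← wordSnocEquiv.hasSum_iff]
  exact hasSum_option_bool_prod (F := F ∘ wordSnocEquiv) hs ht

lemma hasSum_words_cons {F : List Bool → ℝ} {s t : ℝ}
    (hs : HasSum (fun w => F (false :: w)) s) (ht : HasSum (fun w => F (true :: w)) t) :
    HasSum F (F [] + (s + t)) := by
  rw [← wordConsEquiv.hasSum_iff]
  exact hasSum_option_bool_prod (F := F ∘ wordConsEquiv) hs ht

/-- `f ∈ H¹` for a function `f` on one binary branch, whose edges are indexed by binary words. -/
structure BranchH1 (f : List Bool → ℝ → ℝ) : Prop where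
  edge : ∀ w, EdgeH1 (f w)
  glue : ∀ b w, f (b :: w) 0 = f w 1
  summable_mass : Summable fun w => edgeMass (f w)
  summable_kin : Summable fun w => edgeKin (f w)

/-- The sum over the edges of a branch of an edge functional `Φ`. -/
noncomputable def branchSum (Φ : (ℝ → ℝ) → ℝ) (f : List Bool → ℝ → ℝ) : ℝ := ∑' w, Φ (f w)

/-- The function on a branch with the function `a` on the root edge, followed by the functions
`f` and `g` on the two sub-branches attached at the end of the root edge. -/
def graft (a : ℝ → ℝ) (f g : List Bool → ℝ → ℝ) : List Bool → ℝ → ℝ := fun w =>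
  match w.reverse with
  | [] => a
  | false :: t => f t.reverse
  | true :: t => g t.reverse

section graft

variable (a : ℝ → ℝ) (f g : List Bool → ℝ → ℝ)

@[simp] lemma graft_nil : graft a f g [] = a := rfl

@[simp] lemma graft_snoc_false (w : List Bool) : graft a f g (w ++ [false]) = f w := by
  simp [graft]

@[simp] lemma graft_snoc_true (w : List Bool) : graft a f g (w ++ [true]) = g w := by
  simp [graft]

end graft

/-- The restriction to a sub-branch attached at the end of the root edge. -/
def subBranch (b : Bool) (f : List Bool → ℝ → ℝ) : List Bool → ℝ → ℝ := fun w => f (w ++ [b])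

lemma graft_subBranch (f : List Bool → ℝ → ℝ) :
    graft (f []) (subBranch false f) (subBranch true f) = f := by
  ext w
  induction w using List.reverseRecOn with
  | nil => rfl
  | append_singleton w b => cases b <;> simp [subBranch]

lemma hasSum_graft {Φ : (ℝ → ℝ) → ℝ} {a : ℝ → ℝ} {f g : List Bool → ℝ → ℝ}
    (hf : Summable fun w => Φ (f w)) (hg : Summable fun w => Φ (g w)) :
    HasSum (fun w => Φ (graft a f g w)) (Φ a + (branchSum Φ f + branchSum Φ g)) :=
  hasSum_words_snoc (F := fun w => Φ (graft a f g w)) (by simpa [branchSum] using hf.hasSum)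
    (by simpa [branchSum] using hg.hasSum)

lemma branchSum_graft {Φ : (ℝ → ℝ) → ℝ} {a : ℝ → ℝ} {f g : List Bool → ℝ → ℝ}
    (hf : Summable fun w => Φ (f w)) (hg : Summable fun w => Φ (g w)) :
    branchSum Φ (graft a f g) = Φ a + (branchSum Φ f + branchSum Φ g) :=
  (hasSum_graft hf hg).tsum_eq

namespace BranchH1

variable {f g : List Bool → ℝ → ℝ}

protected lemma graft {a : ℝ → ℝ} (ha : EdgeH1 a) (hf : BranchH1 f) (hg : BranchH1 g)
    (h0 : f [] 0 = a 1) (h1 : g [] 0 = a 1) : BranchH1 (graft a f g) where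
  edge w := by
    induction w using List.reverseRecOn with
    | nil => exact ha
    | append_singleton w b =>
      cases b
      · simpa using hf.edge w
      · simpa using hg.edge w
  glue b w := by
    induction w using List.reverseRecOn with
    | nil =>
      cases b
      · simpa using (congrFun (graft_snoc_false a f g []) 0).trans h0
      · simpa using (congrFun (graft_snoc_true a f g []) 0).trans h1
    | append_singleton w c =>
      rw [← List.cons_append]
      cases c
      · simpa only [graft_snoc_false] using hf.glue b w
      · simpa only [graft_snoc_true] using hg.glue b w
  summable_mass := (hasSum_graft hf.summable_mass hg.summable_mass).summable
  summable_kin := (hasSum_graft hf.summable_kin hg.summable_kin).summable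

lemma subBranch (hf : BranchH1 f) (b : Bool) : BranchH1 (subBranch b f) where
  edge _ := hf.edge _
  glue c w := hf.glue c (w ++ [b])
  summable_mass := hf.summable_mass.comp_injective (List.append_left_injective [b])
  summable_kin := hf.summable_kin.comp_injective (List.append_left_injective [b])

lemma subBranch_root (hf : BranchH1 f) (b : Bool) : _root_.subBranch b f [] 0 = f [] 1 :=
  hf.glue b []

protected lemma zero : BranchH1 fun _ _ => 0 where
  edge _ := EdgeH1.const 0
  glue _ _ := rfl
  summable_mass := by simp [edgeMass_const]
  summable_kin := by simp [edgeKin_const]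

lemma branchSum_split {Φ : (ℝ → ℝ) → ℝ} (hΦ : Summable fun w => Φ (f w)) :
    branchSum Φ f = Φ (f []) +
      (branchSum Φ (_root_.subBranch false f) + branchSum Φ (_root_.subBranch true f)) := by
  conv_lhs => rw [← graft_subBranch f]
  exact branchSum_graft (hΦ.comp_injective (List.append_left_injective [false]))
    (hΦ.comp_injective (List.append_left_injective [true]))

/-- The Poincaré inequality on a branch. In passing from the initial to the final points of the
edges, sums of squares over the edges are halved, since every edge is followed by two edges; the
Dirichlet integral has to pay for the difference. -/
lemma mass_le_kin (hf : BranchH1 f) : branchSum edgeMass f ≤ 37 * branchSum edgeKin f := by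
  have hM := hf.summable_mass.hasSum
  have hK := hf.summable_kin.hasSum
  have hend : ∀ x ∈ Icc (0 : ℝ) 1, Summable fun w => f w x ^ 2 := fun x hx => by
    refine Summable.of_nonneg_of_le (fun w => sq_nonneg _) (fun w => ?_)
      ((hM.summable.mul_left 2).add hK.summable)
    have h1 := (hf.edge w).sq_le hx
    have h2 := edgeMass_nonneg (f w)
    have h3 := edgeKin_nonneg (f w)
    have h4 : 2 * √(edgeMass (f w) * edgeKin (f w)) ≤ edgeMass (f w) + edgeKin (f w) := by
      rw [Real.sqrt_mul h2]
      nlinarith [sq_nonneg (√(edgeMass (f w)) - √(edgeKin (f w))), Real.sq_sqrt h2,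
        Real.sq_sqrt h3]
    linarith
  have hB := (hend 0 (by simp)).hasSum
  have hA := (hend 1 (by simp)).hasSum
  set B := ∑' w, f w 0 ^ 2
  set A := ∑' w, f w 1 ^ 2
  have hBA : B = f [] 0 ^ 2 + (A + A) :=
    hB.unique (hasSum_words_cons (F := fun w => f w 0 ^ 2) (by simpa only [hf.glue] using hA)
      (by simpa only [hf.glue] using hA))
  have h1 : B ≤ 3 / 2 * A + 3 * branchSum edgeKin f := by
    refine hasSum_le (fun w => ?_) hB ((hA.mul_left (3 / 2)).add (hK.mul_left 3))
    have := (hf.edge w).sq_sub_le (x := 0) (y := 1) (by simp) (by simp)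
    norm_num at this
    nlinarith [sq_nonneg (2 * (f w 1 - f w 0) + f w 1)]
  have h2 : branchSum edgeMass f ≤ 3 * B + 3 / 4 * branchSum edgeKin f :=
    hasSum_le (fun w => (hf.edge w).edgeMass_le) hM ((hB.mul_left 3).add (hK.mul_left (3 / 4)))
  have h3 : 0 ≤ branchSum edgeKin f := tsum_nonneg fun w => edgeKin_nonneg _
  nlinarith [sq_nonneg (f [] 0)]

end BranchH1

/-! ### Joining branches at the root -/

/-- The function on `joinedBinaryBranches k` with given restrictions to the branches. -/
def joinFun {k : ℕ} (F : Fin k → List Bool → ℝ → ℝ) : (joinedBinaryBranches k).Edge → ℝ → ℝ :=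
  fun e => F e.1 e.2

section joinFun

variable {k : ℕ} {F : Fin k → List Bool → ℝ → ℝ}

lemma summable_fiber {Φ : (ℝ → ℝ) → ℝ}
    (h : Summable fun e : (joinedBinaryBranches k).Edge => Φ (joinFun F e)) (i : Fin k) :
    Summable fun w => Φ (F i w) := by
  have h' : Summable fun e : Fin k × List Bool => Φ (F e.1 e.2) := h
  exact h'.comp_injective (Prod.mk_right_injective i)

lemma memH1_joinFun_iff : (joinedBinaryBranches k).MemH1 (joinFun F) ↔
    (∀ i, BranchH1 (F i)) ∧ ∀ i j, F i [] 0 = F j [] 0 := by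
  rw [UnitMetricGraph.memH1_iff]
  constructor
  · rintro ⟨⟨φ, hφ⟩, h2, h3, h4⟩
    have hsrc : ∀ i b w, F i (b :: w) 0 = φ (some (i, w)) := fun i b w => (hφ (i, b :: w)).1
    have hroot : ∀ i, F i [] 0 = φ none := fun i => (hφ (i, [])).1
    have htgt : ∀ i w, F i w 1 = φ (some (i, w)) := fun i w => (hφ (i, w)).2
    refine ⟨fun i => ⟨fun w => h2 (i, w), fun b w => ?_, ?_, ?_⟩, fun i j => ?_⟩
    · rw [hsrc, htgt]
    · exact summable_fiber h3 i
    · exact summable_fiber h4 i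
    · rw [hroot, hroot]
  · rintro ⟨hF, h0⟩
    have hsum : ∀ {Φ : (ℝ → ℝ) → ℝ}, (∀ f, 0 ≤ Φ f) → (∀ i, Summable fun w => Φ (F i w)) →
        Summable fun e : Fin k × List Bool => Φ (F e.1 e.2) := fun {Φ} h0 h =>
      (summable_prod_of_nonneg fun e => h0 _).2 ⟨h, Summable.of_finite⟩
    refine ⟨?_, fun e => (hF e.1).edge e.2, hsum edgeMass_nonneg fun i => (hF i).summable_mass,
      hsum edgeKin_nonneg fun i => (hF i).summable_kin⟩
    rcases Nat.eq_zero_or_pos k with rfl | hk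
    · exact ⟨fun _ => 0, fun e => e.1.elim0⟩
    refine ⟨fun v => v.elim (F ⟨0, hk⟩ [] 0) fun e => F e.1 e.2 1, ?_⟩
    rintro ⟨i, w⟩
    refine ⟨?_, rfl⟩
    rcases w with _ | ⟨b, w⟩
    · exact h0 _ _
    · exact (hF i).glue b w

lemma hasSum_joinFun {Φ : (ℝ → ℝ) → ℝ} {s : ℝ}
    (h : HasSum (fun e : (joinedBinaryBranches k).Edge => Φ (joinFun F e)) s) :
    (∀ i, Summable fun w => Φ (F i w)) ∧ s = ∑ i, branchSum Φ (F i) := by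
  have h' : HasSum (fun e : Fin k × List Bool => Φ (F e.1 e.2)) s := h
  have h1 : ∀ i, Summable fun w => Φ (F i w) := summable_fiber h.summable
  exact ⟨h1, (h'.prod_fiberwise fun i => (h1 i).hasSum).unique (hasSum_fintype _)⟩

end joinFun

/-- The function on the rooted tree `T₀` given by a function on a branch. -/
def branchFun (f : List Bool → ℝ → ℝ) : rootedBinaryTree.Edge → ℝ → ℝ :=
  joinFun fun _ : Fin 1 => f

/-- The function on the unrooted tree `T` given by functions on its three branches. -/
def treeFun (f g h : List Bool → ℝ → ℝ) : binaryTree.Edge → ℝ → ℝ := joinFun ![f, g, h]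

lemma exists_eq_branchFun (u : rootedBinaryTree.Edge → ℝ → ℝ) : ∃ f, u = branchFun f := by
  refine ⟨fun w => u ((0 : Fin 1), w), funext ?_⟩
  rintro ⟨i, w⟩
  rw [Subsingleton.elim i (0 : Fin 1)]
  rfl

lemma exists_eq_treeFun (u : binaryTree.Edge → ℝ → ℝ) : ∃ f g h, u = treeFun f g h := by
  refine ⟨fun w => u ((0 : Fin 3), w), fun w => u ((1 : Fin 3), w), fun w => u ((2 : Fin 3), w),
    funext ?_⟩
  rintro ⟨i, w⟩
  change Fin 3 at i
  fin_cases i <;> rfl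

section rooted

variable {f : List Bool → ℝ → ℝ} {p : ℝ}

lemma memH1_branchFun_iff : rootedBinaryTree.MemH1 (branchFun f) ↔ BranchH1 f :=
  (memH1_joinFun_iff (k := 1)).trans ⟨fun h => h.1 0, fun h => ⟨fun _ => h, fun _ _ => rfl⟩⟩

lemma BranchH1.mass_branchFun (hf : BranchH1 f) :
    rootedBinaryTree.mass (branchFun f) = branchSum edgeMass f := by
  simpa using (hasSum_joinFun (memH1_branchFun_iff.2 hf).hasSum_mass).2

lemma BranchH1.kinetic_branchFun (hf : BranchH1 f) :
    rootedBinaryTree.kinetic (branchFun f) = branchSum edgeKin f := by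
  simpa using (hasSum_joinFun (memH1_branchFun_iff.2 hf).hasSum_kinetic).2

lemma BranchH1.power_branchFun (hf : BranchH1 f) (hp : 2 ≤ p) :
    rootedBinaryTree.power p (branchFun f) = branchSum (edgePow p) f := by
  simpa using (hasSum_joinFun ((memH1_branchFun_iff.2 hf).hasSum_power hp)).2

lemma BranchH1.summable_pow (hf : BranchH1 f) (hp : 2 ≤ p) :
    Summable fun w => edgePow p (f w) :=
  (hasSum_joinFun ((memH1_branchFun_iff.2 hf).hasSum_power hp)).1 0

end rooted

section tree

variable {f g h : List Bool → ℝ → ℝ} {p : ℝ}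

lemma memH1_treeFun_iff : binaryTree.MemH1 (treeFun f g h) ↔
    BranchH1 f ∧ BranchH1 g ∧ BranchH1 h ∧ f [] 0 = g [] 0 ∧ f [] 0 = h [] 0 := by
  refine (memH1_joinFun_iff (k := 3)).trans ⟨fun H => ⟨H.1 0, H.1 1, H.1 2, H.2 0 1, H.2 0 2⟩, ?_⟩
  rintro ⟨hf, hg, hh, h1, h2⟩
  refine ⟨fun i => by fin_cases i <;> assumption, fun i j => ?_⟩
  have : ∀ i, (![f, g, h] : Fin 3 → List Bool → ℝ → ℝ) i [] 0 = f [] 0 := fun i => by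
    fin_cases i
    · rfl
    · exact h1.symm
    · exact h2.symm
  rw [this, this]

lemma mass_treeFun (H : binaryTree.MemH1 (treeFun f g h)) : binaryTree.mass (treeFun f g h) =
    branchSum edgeMass f + branchSum edgeMass g + branchSum edgeMass h := by
  simpa [Fin.sum_univ_three] using (hasSum_joinFun H.hasSum_mass).2

lemma kinetic_treeFun (H : binaryTree.MemH1 (treeFun f g h)) :
    binaryTree.kinetic (treeFun f g h) =
      branchSum edgeKin f + branchSum edgeKin g + branchSum edgeKin h := by
  simpa [Fin.sum_univ_three] using (hasSum_joinFun H.hasSum_kinetic).2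

lemma power_treeFun (H : binaryTree.MemH1 (treeFun f g h)) (hp : 2 ≤ p) :
    binaryTree.power p (treeFun f g h) =
      branchSum (edgePow p) f + branchSum (edgePow p) g + branchSum (edgePow p) h := by
  simpa [Fin.sum_univ_three] using (hasSum_joinFun (H.hasSum_power hp)).2

end tree

/-! ### The bottom of the spectrum of the trees -/

namespace UnitMetricGraph

variable {G : UnitMetricGraph} {lam : ℝ}

lemma SpectralGap.rayleighInf_eq (hG : G.SpectralGap lam) : G.rayleighInf = lam := by
  refine IsGLB.csInf_eq ⟨?_, fun b hb => ?_⟩ ?_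
  · rintro _ ⟨u, ⟨hu, hM⟩, rfl⟩
    exact (le_div_iff₀ ((mass_nonneg u).lt_of_ne' hM)).2 (hG.le u hu)
  · refine le_of_forall_pos_le_add fun ε hε => ?_
    obtain ⟨u, hu, hM, hK⟩ := hG.sharp ε hε
    exact (hb ⟨u, ⟨hu, hM⟩, rfl⟩).trans
      ((div_lt_iff₀ ((mass_nonneg u).lt_of_ne' hM)).2 hK).le
  · obtain ⟨u, hu, hM, -⟩ := hG.sharp 1 one_pos
    exact ⟨_, u, ⟨hu, hM⟩, rfl⟩

/-- A Poincaré inequality makes the infimum of the Rayleigh quotient a spectral gap. -/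
lemma spectralGap_rayleighInf {C : ℝ} (hC : 0 < C)
    (hP : ∀ u, G.MemH1 u → G.mass u ≤ C * G.kinetic u) (hne : ∃ u, G.MemH1 u ∧ G.mass u ≠ 0) :
    G.SpectralGap G.rayleighInf := by
  have hlow : ∀ x ∈ (fun u => G.kinetic u / G.mass u) '' {u | G.MemH1 u ∧ G.mass u ≠ 0},
      C⁻¹ ≤ x := by
    rintro _ ⟨u, ⟨hu, hM⟩, rfl⟩
    rw [le_div_iff₀ ((mass_nonneg u).lt_of_ne' hM), inv_mul_le_iff₀ hC]
    exact hP u hu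
  have hbdd : BddBelow ((fun u => G.kinetic u / G.mass u) '' {u | G.MemH1 u ∧ G.mass u ≠ 0}) :=
    ⟨_, hlow⟩
  have hnon : ((fun u => G.kinetic u / G.mass u) '' {u | G.MemH1 u ∧ G.mass u ≠ 0}).Nonempty := by
    obtain ⟨u, hu⟩ := hne
    exact ⟨_, u, hu, rfl⟩
  refine ⟨(inv_pos.2 hC).trans_le (le_csInf hnon hlow), fun u hu => ?_, fun ε hε => ?_⟩
  · by_cases hM : G.mass u = 0
    · rw [hM, mul_zero]; exact kinetic_nonneg u
    · rw [← le_div_iff₀ ((mass_nonneg u).lt_of_ne' hM)]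
      exact csInf_le hbdd ⟨u, ⟨hu, hM⟩, rfl⟩
  · obtain ⟨_, ⟨u, ⟨hu, hM⟩, rfl⟩, hlt⟩ := exists_lt_of_csInf_lt hnon
      (lt_add_of_pos_right G.rayleighInf hε)
    exact ⟨u, hu, hM, (div_lt_iff₀ ((mass_nonneg u).lt_of_ne' hM)).1 hlt⟩

end UnitMetricGraph

open UnitMetricGraph

lemma branchSum_nonneg {Φ : (ℝ → ℝ) → ℝ} (hΦ : ∀ f, 0 ≤ Φ f) (f : List Bool → ℝ → ℝ) :
    0 ≤ branchSum Φ f := tsum_nonneg fun _ => hΦ _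

/-- The function descending linearly from the value `c` at the root to `0` along the root edge of
a branch, and vanishing beyond it. -/
noncomputable def tent (c : ℝ) : List Bool → ℝ → ℝ :=
  graft (fun x => c * (1 - x)) (fun _ _ => 0) fun _ _ => 0

section tent

variable (c : ℝ)

lemma branchH1_tent : BranchH1 (tent c) :=
  BranchH1.graft (edgeH1_one_sub.const_mul c) BranchH1.zero BranchH1.zero (by simp) (by simp)

lemma tent_root : tent c [] 0 = c := by simp [tent]

lemma branchSum_edgeMass_tent : branchSum edgeMass (tent c) = c ^ 2 / 3 := by
  rw [tent, branchSum_graft BranchH1.zero.summable_mass BranchH1.zero.summable_mass,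
    edgeMass_const_mul, edgeMass_one_sub]
  simp [branchSum, edgeMass_const]
  ring

lemma branchSum_edgeKin_tent : branchSum edgeKin (tent c) = c ^ 2 := by
  rw [tent, branchSum_graft BranchH1.zero.summable_kin BranchH1.zero.summable_kin,
    edgeKin_const_mul, edgeKin_one_sub]
  simp [branchSum, edgeKin_const]

end tent

lemma BranchH1.memH1_treeFun_self {f : List Bool → ℝ → ℝ} (hf : BranchH1 f) :
    binaryTree.MemH1 (treeFun f f f) := memH1_treeFun_iff.2 ⟨hf, hf, hf, rfl, rfl⟩

lemma spectralGap_binaryTree : binaryTree.SpectralGap lambda1 := by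
  refine spectralGap_rayleighInf (C := 37) (by norm_num) (fun u hu => ?_)
    ⟨treeFun (tent 1) (tent 1) (tent 1), (branchH1_tent 1).memH1_treeFun_self, ?_⟩
  · obtain ⟨f, g, h, rfl⟩ := exists_eq_treeFun u
    obtain ⟨hf, hg, hh, -⟩ := memH1_treeFun_iff.1 hu
    rw [mass_treeFun hu, kinetic_treeFun hu]
    linarith [hf.mass_le_kin, hg.mass_le_kin, hh.mass_le_kin]
  · rw [mass_treeFun (branchH1_tent 1).memH1_treeFun_self, branchSum_edgeMass_tent]
    norm_num

lemma BranchH1.lambda1_mul_le {f : List Bool → ℝ → ℝ} (hf : BranchH1 f) :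
    lambda1 * branchSum edgeMass f ≤ branchSum edgeKin f := by
  have h := spectralGap_binaryTree.le _ hf.memH1_treeFun_self
  rw [mass_treeFun hf.memH1_treeFun_self, kinetic_treeFun hf.memH1_treeFun_self] at h
  linarith

/-- Both trees have the same bottom of the spectrum: a function on `T₀` can be copied to the three
branches of `T`, and a function on `T` is made of three functions on `T₀`. -/
lemma spectralGap_rootedBinaryTree : rootedBinaryTree.SpectralGap lambda1 := by
  refine ⟨spectralGap_binaryTree.pos, fun u hu => ?_, fun ε hε => ?_⟩
  · obtain ⟨f, rfl⟩ := exists_eq_branchFun u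
    have hf := memH1_branchFun_iff.1 hu
    rw [hf.mass_branchFun, hf.kinetic_branchFun]
    exact hf.lambda1_mul_le
  · by_contra! hcon
    obtain ⟨u, hu, hM, hK⟩ := spectralGap_binaryTree.sharp ε hε
    have key : ∀ f, BranchH1 f →
        (lambda1 + ε) * branchSum edgeMass f ≤ branchSum edgeKin f := fun f hf => by
      by_cases h0 : branchSum edgeMass f = 0
      · rw [h0, mul_zero]; exact branchSum_nonneg edgeKin_nonneg f
      · have := hcon (branchFun f) (memH1_branchFun_iff.2 hf) (by rwa [hf.mass_branchFun])
        rwa [hf.mass_branchFun, hf.kinetic_branchFun] at this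
    obtain ⟨f, g, h, rfl⟩ := exists_eq_treeFun u
    obtain ⟨hf, hg, hh, -⟩ := memH1_treeFun_iff.1 hu
    rw [mass_treeFun hu, kinetic_treeFun hu] at hK
    linarith [key f hf, key g hg, key h hh]

/-! ### The sup norm and the spectral deficit -/

/-- On a branch, the spectral deficit controls the value at the root. This follows from the
Poincaré inequality for the function which is constant on a new root edge and continues with two
copies of the given function: the new edge has mass but no Dirichlet integral. -/
lemma BranchH1.root_sq_le {f : List Bool → ℝ → ℝ} (hf : BranchH1 f) :
    lambda1 / 2 * f [] 0 ^ 2 ≤ branchSum edgeKin f - lambda1 * branchSum edgeMass f := by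
  have h := (BranchH1.graft (EdgeH1.const (f [] 0)) hf hf rfl rfl).lambda1_mul_le
  rw [branchSum_graft hf.summable_mass hf.summable_mass,
    branchSum_graft hf.summable_kin hf.summable_kin, edgeMass_const, edgeKin_const] at h
  linarith

lemma lambda1_le : lambda1 ≤ 6 / 5 := by
  have h := (branchH1_tent 1).root_sq_le
  rw [tent_root, branchSum_edgeMass_tent, branchSum_edgeKin_tent] at h
  linarith

/-- On an edge at the root, the sup norm is controlled by the spectral deficit. -/
lemma sq_le_deficit_of_root {f g h : List Bool → ℝ → ℝ}
    (H : binaryTree.MemH1 (treeFun f g h)) {x : ℝ} (hx : x ∈ Icc (0 : ℝ) 1) :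
    f [] x ^ 2 ≤ (2 / lambda1 + 48) * (binaryTree.kinetic (treeFun f g h)
      - lambda1 * binaryTree.mass (treeFun f g h)) := by
  obtain ⟨hf, hg, hh, hfg, hfh⟩ := memH1_treeFun_iff.1 H
  have hlam := spectralGap_binaryTree.pos
  rw [mass_treeFun H, kinetic_treeFun H]
  set c := f [] 0
  have hDf := hf.root_sq_le
  have hDg := hg.root_sq_le
  have hDh := hh.root_sq_le
  rw [← hfg] at hDg
  rw [← hfh] at hDh
  have hc : lambda1 / 2 * f [] 0 ^ 2 = lambda1 / 2 * c ^ 2 := rfl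
  rw [hc] at hDf hDg hDh
  -- the deficit of the whole tree dominates the deficit of the edge
  have hK := BranchH1.branchSum_split hf.summable_kin
  have hM := BranchH1.branchSum_split hf.summable_mass
  have hs0 := (hf.subBranch false).lambda1_mul_le
  have hs1 := (hf.subBranch true).lambda1_mul_le
  have hE := (hf.edge []).edgeMass_le
  have hE' := mul_le_mul_of_nonneg_left hE hlam.le
  have hk0 := edgeKin_nonneg (f [])
  have hk1 := mul_le_mul_of_nonneg_right lambda1_le hk0
  have hx2 := (hf.edge []).sq_sub_le (left_mem_Icc.2 zero_le_one) hx
  rw [sub_zero, abs_of_nonneg hx.1] at hx2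
  have hx3 : x * edgeKin (f []) ≤ edgeKin (f []) := mul_le_of_le_one_left hk0 hx.2
  have hx4 : f [] x ^ 2 ≤ 2 * c ^ 2 + 2 * edgeKin (f []) := by
    nlinarith [sq_nonneg (f [] x - 2 * f [] 0)]
  set D := branchSum edgeKin f + branchSum edgeKin g + branchSum edgeKin h -
    lambda1 * (branchSum edgeMass f + branchSum edgeMass g + branchSum edgeMass h) with hD
  have hlc : lambda1 * c ^ 2 ≤ D := by
    have : 0 ≤ lambda1 * c ^ 2 := by positivity
    linarith
  have hlc' : 3 / 2 * (lambda1 * c ^ 2) ≤ D := by linarith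
  have hek : edgeKin (f []) ≤ 24 * D := by
    have e1 : branchSum edgeKin f - lambda1 * branchSum edgeMass f
        ≥ edgeKin (f []) - lambda1 * edgeMass (f []) := by
      rw [hK, hM]; linarith
    have e2 : lambda1 * edgeMass (f []) ≤ 3 * (lambda1 * c ^ 2) + 9 / 10 * edgeKin (f []) := by
      linarith
    linarith
  have hc2 : 2 * c ^ 2 ≤ 2 / lambda1 * D := by
    rw [div_mul_eq_mul_div, le_div_iff₀ hlam]
    linarith
  linarith

/-! ### Moving the root of the unrooted tree -/

/-- `v` is a function in `H¹(T)` with the same integrals as `u`, as happens when `v` is obtained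
from `u` by an isometry of the tree. -/
structure SameIntegrals (p : ℝ) (u v : binaryTree.Edge → ℝ → ℝ) : Prop where
  memH1 : binaryTree.MemH1 v
  mass : binaryTree.mass v = binaryTree.mass u
  kinetic : binaryTree.kinetic v = binaryTree.kinetic u
  power : binaryTree.power p v = binaryTree.power p u

namespace SameIntegrals

variable {p : ℝ} {u v w : binaryTree.Edge → ℝ → ℝ} {f g h : List Bool → ℝ → ℝ}

lemma refl (hu : binaryTree.MemH1 u) : SameIntegrals p u u := ⟨hu, rfl, rfl, rfl⟩

lemma trans (h : SameIntegrals p u v) (h' : SameIntegrals p v w) : SameIntegrals p u w :=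
  ⟨h'.memH1, h'.mass.trans h.mass, h'.kinetic.trans h.kinetic, h'.power.trans h.power⟩

lemma energy (h : SameIntegrals p u v) : binaryTree.energy p v = binaryTree.energy p u := by
  rw [energy_eq, energy_eq, h.kinetic, h.power]

lemma swap (hp : 2 ≤ p) (H : binaryTree.MemH1 (treeFun f g h)) :
    SameIntegrals p (treeFun f g h) (treeFun g f h) := by
  obtain ⟨hf, hg, hh, h1, h2⟩ := memH1_treeFun_iff.1 H
  have H' : binaryTree.MemH1 (treeFun g f h) :=
    memH1_treeFun_iff.2 ⟨hg, hf, hh, h1.symm, h1.symm.trans h2⟩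
  refine ⟨H', ?_, ?_, ?_⟩
  · rw [mass_treeFun H, mass_treeFun H']; ring
  · rw [kinetic_treeFun H, kinetic_treeFun H']; ring
  · rw [power_treeFun H hp, power_treeFun H' hp]; ring

lemma swap_last (hp : 2 ≤ p) (H : binaryTree.MemH1 (treeFun f g h)) :
    SameIntegrals p (treeFun f g h) (treeFun f h g) := by
  obtain ⟨hf, hg, hh, h1, h2⟩ := memH1_treeFun_iff.1 H
  have H' : binaryTree.MemH1 (treeFun f h g) := memH1_treeFun_iff.2 ⟨hf, hh, hg, h2, h1⟩
  refine ⟨H', ?_, ?_, ?_⟩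
  · rw [mass_treeFun H, mass_treeFun H']; ring
  · rw [kinetic_treeFun H, kinetic_treeFun H']; ring
  · rw [power_treeFun H hp, power_treeFun H' hp]; ring

/-- Moving the root across the root edge of the first branch: the sub-branches of the first branch
become branches, and the other two branches become the sub-branches at the end of the reversed
edge. -/
lemma reroot (hp : 2 ≤ p) (H : binaryTree.MemH1 (treeFun f g h)) :
    SameIntegrals p (treeFun f g h)
      (treeFun (graft (fun x => f [] (1 - x)) g h) (subBranch false f) (subBranch true f)) := by
  obtain ⟨hf, hg, hh, h1, h2⟩ := memH1_treeFun_iff.1 H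
  have hgr : BranchH1 (graft (fun x => f [] (1 - x)) g h) :=
    BranchH1.graft (hf.edge []).reverse hg hh (by simpa using h1.symm) (by simpa using h2.symm)
  have H' : binaryTree.MemH1 (treeFun (graft (fun x => f [] (1 - x)) g h)
      (subBranch false f) (subBranch true f)) :=
    memH1_treeFun_iff.2 ⟨hgr, hf.subBranch false, hf.subBranch true,
      by simp [hf.subBranch_root], by simp [hf.subBranch_root]⟩
  refine ⟨H', ?_, ?_, ?_⟩
  · rw [mass_treeFun H, mass_treeFun H', branchSum_graft hg.summable_mass hh.summable_mass,
      edgeMass_reverse, BranchH1.branchSum_split hf.summable_mass]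
    ring
  · rw [kinetic_treeFun H, kinetic_treeFun H', branchSum_graft hg.summable_kin hh.summable_kin,
      edgeKin_reverse, BranchH1.branchSum_split hf.summable_kin]
    ring
  · rw [power_treeFun H hp, power_treeFun H' hp,
      branchSum_graft (hg.summable_pow hp) (hh.summable_pow hp),
      edgePow_reverse, BranchH1.branchSum_split (hf.summable_pow hp)]
    ring

end SameIntegrals

lemma exists_sameIntegrals_branch {p : ℝ} (hp : 2 ≤ p) (w : List Bool) :
    ∀ f g h, binaryTree.MemH1 (treeFun f g h) →
      ∃ f' g' h', SameIntegrals p (treeFun f g h) (treeFun f' g' h') ∧ f' [] = f w := by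
  induction w using List.reverseRecOn with
  | nil => exact fun f g h H => ⟨f, g, h, .refl H, rfl⟩
  | append_singleton w b ih =>
    intro f g h H
    have h1 := SameIntegrals.reroot hp H
    have h2 := h1.trans (.swap hp h1.memH1)
    cases b
    · obtain ⟨f', g', h', h3, h4⟩ := ih _ _ _ h2.memH1
      exact ⟨f', g', h', h2.trans h3, h4⟩
    · have h1' := h1.trans (.swap_last hp h1.memH1)
      have h2' := h1'.trans (.swap hp h1'.memH1)
      obtain ⟨f', g', h', h3, h4⟩ := ih _ _ _ h2'.memH1
      exact ⟨f', g', h', h2'.trans h3, h4⟩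

/-- Every edge of the unrooted tree can be moved to the root. -/
lemma exists_sameIntegrals_edge {p : ℝ} (hp : 2 ≤ p) {u : binaryTree.Edge → ℝ → ℝ}
    (hu : binaryTree.MemH1 u) (e : binaryTree.Edge) :
    ∃ f g h, SameIntegrals p u (treeFun f g h) ∧ f [] = u e := by
  obtain ⟨f, g, h, rfl⟩ := exists_eq_treeFun u
  obtain ⟨i, w⟩ := e
  change Fin 3 at i
  fin_cases i
  · exact exists_sameIntegrals_branch hp w f g h hu
  · have h1 := SameIntegrals.swap hp hu
    obtain ⟨f', g', h', h3, h4⟩ := exists_sameIntegrals_branch hp w _ _ _ h1.memH1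
    exact ⟨f', g', h', h1.trans h3, h4⟩
  · have h1 := SameIntegrals.swap_last hp hu
    have h2 := h1.trans (.swap hp h1.memH1)
    obtain ⟨f', g', h', h3, h4⟩ := exists_sameIntegrals_branch hp w _ _ _ h2.memH1
    exact ⟨f', g', h', h2.trans h3, h4⟩

/-- The root can be moved so far out that almost all of the mass sits in one branch. -/
lemma exists_sameIntegrals_small_branches {p : ℝ} (hp : 2 ≤ p) {u : binaryTree.Edge → ℝ → ℝ}
    (hu : binaryTree.MemH1 u) (n : ℕ) : ∃ f g h, SameIntegrals p u (treeFun f g h) ∧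
      branchSum edgeMass g + branchSum edgeMass h ≤ binaryTree.mass u / 2 ^ n := by
  induction n with
  | zero =>
    obtain ⟨f, g, h, rfl⟩ := exists_eq_treeFun u
    refine ⟨f, g, h, .refl hu, ?_⟩
    rw [mass_treeFun hu]
    have := branchSum_nonneg edgeMass_nonneg f
    simp only [pow_zero, div_one]
    linarith
  | succ n ih =>
    -- step into the lighter of the two light branches
    obtain ⟨f, g, h, h1, h2, h3⟩ : ∃ f g h, SameIntegrals p u (treeFun f g h) ∧
        branchSum edgeMass g + branchSum edgeMass h ≤ binaryTree.mass u / 2 ^ n ∧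
        branchSum edgeMass g ≤ branchSum edgeMass h := by
      obtain ⟨f, g, h, h1, h2⟩ := ih
      rcases le_total (branchSum edgeMass g) (branchSum edgeMass h) with h3 | h3
      · exact ⟨f, g, h, h1, h2, h3⟩
      · exact ⟨f, h, g, h1.trans (.swap_last hp h1.memH1), by rwa [add_comm], h3⟩
    have h4 := h1.trans (.swap hp h1.memH1)
    have h5 := h4.trans (.reroot hp h4.memH1)
    have hg := (memH1_treeFun_iff.1 h1.memH1).2.1
    refine ⟨_, _, _, h5, ?_⟩
    have h6 := BranchH1.branchSum_split hg.summable_mass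
    have h7 := edgeMass_nonneg (g [])
    have h8 : binaryTree.mass u / 2 ^ (n + 1) = binaryTree.mass u / 2 ^ n / 2 := by
      rw [pow_succ]; field_simp
    linarith

lemma deficit_constant_nonneg : 0 ≤ 2 / lambda1 + 48 := by
  have := spectralGap_binaryTree.pos
  positivity

lemma sq_le_deficit_binaryTree {u : binaryTree.Edge → ℝ → ℝ} (hu : binaryTree.MemH1 u)
    (e : binaryTree.Edge) {x : ℝ} (hx : x ∈ Icc (0 : ℝ) 1) :
    u e x ^ 2 ≤ (2 / lambda1 + 48) * (binaryTree.kinetic u - lambda1 * binaryTree.mass u) := by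
  obtain ⟨f, g, h, h1, h2⟩ := exists_sameIntegrals_edge le_rfl hu e
  have := sq_le_deficit_of_root h1.memH1 hx
  rwa [h1.kinetic, h1.mass, h2] at this

lemma sq_le_deficit_rootedBinaryTree {u : rootedBinaryTree.Edge → ℝ → ℝ}
    (hu : rootedBinaryTree.MemH1 u) (e : rootedBinaryTree.Edge) {x : ℝ}
    (hx : x ∈ Icc (0 : ℝ) 1) : u e x ^ 2 ≤ 3 * (2 / lambda1 + 48) *
      (rootedBinaryTree.kinetic u - lambda1 * rootedBinaryTree.mass u) := by
  obtain ⟨f, rfl⟩ := exists_eq_branchFun u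
  have hf := memH1_branchFun_iff.1 hu
  have := sq_le_deficit_binaryTree hf.memH1_treeFun_self ((0 : Fin 3), e.2) hx
  rw [mass_treeFun hf.memH1_treeFun_self, kinetic_treeFun hf.memH1_treeFun_self] at this
  rw [hf.mass_branchFun, hf.kinetic_branchFun]
  refine le_trans this (le_of_eq ?_)
  ring

/-! ### Existence of ground states -/

namespace UnitMetricGraph

variable {G : UnitMetricGraph} {p : ℝ}

/-- There are functions of mass arbitrarily close to `μ`, and of energy exceeding `ℓ` by
arbitrarily little, whose sup norm is at least `c`. -/
def NonvanishingNear (G : UnitMetricGraph) (p μ ℓ c : ℝ) : Prop :=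
  ∀ ε > 0, ∃ u, G.MemH1 u ∧ |G.mass u - μ| ≤ ε ∧ G.energy p u ≤ ℓ + ε ∧
    ∃ e, ∃ x ∈ Icc (0 : ℝ) 1, c ≤ |u e x|

lemma SpectralGap.exists_nonvanishingNear {lam : ℝ} (hG : G.SpectralGap lam) (hp2 : 2 < p)
    {μ : ℝ} (hμ : 0 < μ) (h : G.level p μ < 1 / 2 * lam * μ) :
    ∃ c > 0, G.NonvanishingNear p μ (G.level p μ) c := by
  set η := (1 / 2 * lam * μ - G.level p μ) / 2 with hη
  have hη0 : 0 < η := by rw [hη]; linarith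
  obtain ⟨c, hc, H⟩ := hG.exists_le_abs_of_energy hp2 hη0 hμ
  refine ⟨c, hc, fun ε hε => ?_⟩
  have hm : 0 < min ε η := lt_min hε hη0
  obtain ⟨u, hu, hE⟩ := hG.exists_energy_lt hμ.le
    (show G.level p μ < G.level p μ + min ε η by linarith)
  refine ⟨u, hu.1, by rw [hu.2, sub_self, abs_zero]; exact hε.le, ?_, H u hu ?_⟩
  · linarith [min_le_left ε η]
  · linarith [min_le_right ε η]

/-- Above a mass with linear level the level is strictly below the linear one. For `p > 4` the
nonlinear term can then compensate the spectral deficit only if the sup norm is bounded below. -/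
lemma SpectralGap.exists_nonvanishingNear_of_isGreatest {lam : ℝ} (hG : G.SpectralGap lam)
    (hp4 : 4 < p) {C : ℝ} (hC0 : 0 ≤ C)
    (hC : ∀ u, G.MemH1 u → ∀ e, ∀ x ∈ Icc (0 : ℝ) 1,
      u e x ^ 2 ≤ C * (G.kinetic u - lam * G.mass u)) {μ : ℝ} (hμ : 0 < μ)
    (hlin : G.level p μ = 1 / 2 * lam * μ) (h : ∀ ν > μ, G.level p ν < 1 / 2 * lam * ν) :
    ∃ c > 0, G.NonvanishingNear p μ (G.level p μ) c := by
  have hlam := hG.pos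
  refine ⟨(p / 2 / (C * (μ + 1) + 1)) ^ (1 / (p - 4)), by positivity, fun ε hε => ?_⟩
  set c := (p / 2 / (C * (μ + 1) + 1)) ^ (1 / (p - 4)) with hc
  set δ := min 1 (ε / (1 + lam))
  have hδ0 : 0 < δ := lt_min one_pos (by positivity)
  have hδ1 : δ ≤ 1 := min_le_left _ _
  have hδ2 : δ * (1 + lam) ≤ ε := by
    rw [← le_div_iff₀ (by linarith)]; exact min_le_right _ _
  obtain ⟨u, hu, hE⟩ := hG.exists_energy_lt (by linarith : 0 ≤ μ + δ)
    (h (μ + δ) (by linarith))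
  have hδlam : 0 < δ * lam := mul_pos hδ0 hlam
  refine ⟨u, hu.1, ?_, ?_, ?_⟩
  · rw [hu.2, add_sub_cancel_left, abs_of_pos hδ0]; linarith
  · rw [hlin]; linarith
  · by_contra! hcon
    have hcp : c ^ (p - 4) = p / 2 / (C * (μ + 1) + 1) := by
      rw [hc, ← Real.rpow_mul (by positivity), one_div_mul_cancel (by linarith), Real.rpow_one]
    have h1 := hG.half_mul_mass_le_energy (by linarith) hp4.le hu.1 (hC u hu.1) hC0
      (by positivity : 0 ≤ c) (fun e x hx => (hcon e x hx).le) (by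
        rw [hcp, hu.2]
        calc C * (p / 2 / (C * (μ + 1) + 1)) * (μ + δ)
            ≤ C * (p / 2 / (C * (μ + 1) + 1)) * (μ + 1) := by gcongr
          _ = p / 2 * ((C * (μ + 1)) / (C * (μ + 1) + 1)) := by ring
          _ ≤ p / 2 * 1 := by
            gcongr
            rw [div_le_one (by positivity)]; linarith
          _ = p / 2 := mul_one _)
    rw [hu.2] at h1
    linarith

end UnitMetricGraph

section Existence

variable {p : ℝ} (hp2 : 2 < p) (hp6 : p < 6)
include hp2 hp6

/-- On the unrooted tree, nonvanishing almost minimizers can be moved to the root. -/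
lemma exists_energy_le_binaryTree {μ ℓ c : ℝ} (hμ : 0 < μ) (hc : 0 < c)
    (hℓ : ℓ ≤ binaryTree.level p μ) (H : binaryTree.NonvanishingNear p μ ℓ c) :
    ∃ v ∈ binaryTree.H1mass μ, binaryTree.energy p v ≤ ℓ := by
  refine exists_energy_le_of_not_vanishing hp2 hp6 hμ hℓ hc ((0 : Fin 3), []) fun ε hε => ?_
  obtain ⟨u, hu, hM, hE, e, x, hx, hcx⟩ := H ε hε
  obtain ⟨f, g, h, h1, h2⟩ := exists_sameIntegrals_edge hp2.le hu e
  refine ⟨_, h1.memH1, by rwa [h1.mass], by rwa [h1.energy], x, hx, ?_⟩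
  change c ≤ |f [] x|
  rwa [h2]

omit hp6 in
/-- Nonvanishing almost minimizers on `T₀` which vanish at the root are, up to a small error,
functions on `T`. -/
lemma exists_nonvanishingNear_binaryTree {μ ℓ c : ℝ}
    (H : ∀ ε > 0, ∀ δ > 0, ∃ f, BranchH1 f ∧ |rootedBinaryTree.mass (branchFun f) - μ| ≤ ε ∧
      rootedBinaryTree.energy p (branchFun f) ≤ ℓ + ε ∧ |f [] 0| ≤ δ ∧
      ∃ w, ∃ x ∈ Icc (0 : ℝ) 1, c ≤ |f w x|) :
    binaryTree.NonvanishingNear p μ ℓ c := by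
  intro ε hε
  obtain ⟨f, hf, hM, hE, h0, w, x, hx, hcx⟩ := H (ε / 2) (by linarith) √(ε / 2) (by positivity)
  set a := f [] 0
  have ha : a ^ 2 ≤ ε / 2 := by
    have := pow_le_pow_left₀ (abs_nonneg a) h0 2
    rwa [sq_abs, Real.sq_sqrt (by linarith)] at this
  have hT : binaryTree.MemH1 (treeFun f (tent a) (tent a)) :=
    memH1_treeFun_iff.2 ⟨hf, branchH1_tent a, branchH1_tent a, (tent_root a).symm,
      (tent_root a).symm⟩
  refine ⟨_, hT, ?_, ?_, ((0 : Fin 3), w), x, hx, hcx⟩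
  · rw [mass_treeFun hT, branchSum_edgeMass_tent, ← hf.mass_branchFun]
    have h1 := _root_.abs_le.1 hM
    rw [_root_.abs_le]
    constructor <;> linarith [sq_nonneg a, h1.1, h1.2]
  · rw [energy_eq, kinetic_treeFun hT, power_treeFun hT hp2.le, branchSum_edgeKin_tent]
    rw [energy_eq, hf.kinetic_branchFun, hf.power_branchFun hp2.le] at hE
    have h1 : 0 ≤ 1 / p * branchSum (edgePow p) (tent a) :=
      mul_nonneg (by positivity) (branchSum_nonneg (edgePow_nonneg p) _)
    linarith

omit hp6 in
/-- A function on `T` yields one on `T₀` of the same mass and of no larger energy, if the cost of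
small masses on `T₀` is at least proportional: cut off two light branches and rescale. -/
lemma exists_energy_le_rootedBinaryTree_of_binaryTree {μ ℓ ε : ℝ} (hμ : 0 < μ) (hε : 0 < ε)
    (hsmall : ∀ u, rootedBinaryTree.MemH1 u → rootedBinaryTree.mass u ≤ ε →
      ℓ / μ * rootedBinaryTree.mass u ≤ rootedBinaryTree.energy p u)
    {u : binaryTree.Edge → ℝ → ℝ} (hu : u ∈ binaryTree.H1mass μ)
    (hE : binaryTree.energy p u ≤ ℓ) :
    ∃ v ∈ rootedBinaryTree.H1mass μ, rootedBinaryTree.energy p v ≤ ℓ := by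
  obtain ⟨n, hn⟩ := exists_pow_lt_of_lt_one
    (show 0 < min ε (μ / 2) / μ from div_pos (lt_min hε (by linarith)) hμ)
    (by norm_num : (1 / 2 : ℝ) < 1)
  obtain ⟨f, g, h, h1, h2⟩ := exists_sameIntegrals_small_branches hp2.le hu.1 n
  obtain ⟨hf, hg, hh, -⟩ := memH1_treeFun_iff.1 h1.memH1
  have h3 : branchSum edgeMass g + branchSum edgeMass h ≤ min ε (μ / 2) := by
    refine h2.trans ?_
    rw [hu.2, div_eq_mul_inv, ← inv_pow, ← one_div, mul_comm]
    exact ((lt_div_iff₀ hμ).1 hn).le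
  have hg0 := branchSum_nonneg edgeMass_nonneg g
  have hh0 := branchSum_nonneg edgeMass_nonneg h
  have hmass := h1.mass
  have henergy := h1.energy
  rw [hu.2, mass_treeFun h1.memH1] at hmass
  have hsg := hsmall (branchFun g) (memH1_branchFun_iff.2 hg) (by
    rw [hg.mass_branchFun]; linarith [min_le_left ε (μ / 2)])
  have hsh := hsmall (branchFun h) (memH1_branchFun_iff.2 hh) (by
    rw [hh.mass_branchFun]; linarith [min_le_left ε (μ / 2)])
  have hE' : binaryTree.energy p (treeFun f g h) = rootedBinaryTree.energy p (branchFun f) +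
      rootedBinaryTree.energy p (branchFun g) + rootedBinaryTree.energy p (branchFun h) := by
    simp only [energy_eq]
    rw [kinetic_treeFun h1.memH1, power_treeFun h1.memH1 hp2.le, hf.kinetic_branchFun,
      hg.kinetic_branchFun, hh.kinetic_branchFun, hf.power_branchFun hp2.le,
      hg.power_branchFun hp2.le, hh.power_branchFun hp2.le]
    ring
  rw [hg.mass_branchFun] at hsg
  rw [hh.mass_branchFun] at hsh
  have hMf : 0 < rootedBinaryTree.mass (branchFun f) := by
    rw [hf.mass_branchFun]
    linarith [min_le_right ε (μ / 2)]
  have hMf' : rootedBinaryTree.mass (branchFun f) ≤ μ := by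
    rw [hf.mass_branchFun]; linarith
  obtain ⟨v, hv, hvE, -⟩ := (memH1_branchFun_iff.2 hf).exists_scale hp2 hMf hMf'
  refine ⟨v, hv, hvE.trans ?_⟩
  have hEf : rootedBinaryTree.energy p (branchFun f) ≤
      ℓ / μ * rootedBinaryTree.mass (branchFun f) := by
    have h4 : rootedBinaryTree.mass (branchFun f) =
        μ - branchSum edgeMass g - branchSum edgeMass h := by
      rw [hf.mass_branchFun]; linarith
    have h5 : ℓ / μ * μ = ℓ := div_mul_cancel₀ _ hμ.ne'
    rw [h4, mul_sub, mul_sub, h5]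
    linarith
  calc _ ≤ μ / rootedBinaryTree.mass (branchFun f) *
        (ℓ / μ * rootedBinaryTree.mass (branchFun f)) := by gcongr
    _ = ℓ := by field_simp

/-- On the rooted tree, nonvanishing almost minimizers either converge near the root, or give rise
to a function on the unrooted tree, which can be brought back to the rooted tree. -/
lemma exists_energy_le_rootedBinaryTree {μ c ε : ℝ} (hμ : 0 < μ) (hc : 0 < c) (hε : 0 < ε)
    (hsmall : ∀ u, rootedBinaryTree.MemH1 u → rootedBinaryTree.mass u ≤ ε →
      rootedBinaryTree.level p μ / μ * rootedBinaryTree.mass u ≤ rootedBinaryTree.energy p u)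
    (H : rootedBinaryTree.NonvanishingNear p μ (rootedBinaryTree.level p μ) c) :
    ∃ v ∈ rootedBinaryTree.H1mass μ,
      rootedBinaryTree.energy p v ≤ rootedBinaryTree.level p μ := by
  set ℓ := rootedBinaryTree.level p μ with hℓ
  -- either the values at the root stay away from zero along suitable almost minimizers, or they
  -- are forced to be small
  by_cases hA : ∃ δ > 0, ∀ ε > 0, ∃ u, rootedBinaryTree.MemH1 u ∧
      |rootedBinaryTree.mass u - μ| ≤ ε ∧ rootedBinaryTree.energy p u ≤ ℓ + ε ∧
      δ ≤ |u ((0 : Fin 1), []) 0|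
  · obtain ⟨δ, hδ, hA⟩ := hA
    refine exists_energy_le_of_not_vanishing hp2 hp6 hμ le_rfl hδ ((0 : Fin 1), []) fun ε hε => ?_
    obtain ⟨u, hu, hM, hE, h0⟩ := hA ε hε
    exact ⟨u, hu, hM, hE, 0, by simp, h0⟩
  · push Not at hA
    have hT : binaryTree.NonvanishingNear p μ ℓ c := by
      refine exists_nonvanishingNear_binaryTree hp2 fun ε hε δ hδ => ?_
      obtain ⟨ε', hε', hA'⟩ := hA δ hδ
      obtain ⟨u, hu, hM, hE, e, x, hx, hcx⟩ := H (min ε ε') (lt_min hε hε')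
      have h0 := hA' u hu (hM.trans (min_le_right _ _)) (by linarith [min_le_right ε ε'])
      obtain ⟨f, rfl⟩ := exists_eq_branchFun u
      exact ⟨f, memH1_branchFun_iff.1 hu, hM.trans (min_le_left _ _),
        by linarith [min_le_left ε ε'], h0.le, e.2, x, hx, hcx⟩
    obtain ⟨u, hu, hE⟩ : ∃ u ∈ binaryTree.H1mass μ, binaryTree.energy p u ≤ ℓ := by
      rcases le_or_gt ℓ (binaryTree.level p μ) with hle | hlt
      · exact exists_energy_le_binaryTree hp2 hp6 hμ hc hle hT
      · obtain ⟨d, hd, hT'⟩ := spectralGap_binaryTree.exists_nonvanishingNear hp2 hμ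
          (hlt.trans_le (spectralGap_rootedBinaryTree.level_le hp2 hp6 hμ.le))
        obtain ⟨u, hu, hE⟩ := exists_energy_le_binaryTree hp2 hp6 hμ hd le_rfl hT'
        exact ⟨u, hu, hE.trans hlt.le⟩
    exact exists_energy_le_rootedBinaryTree_of_binaryTree hp2 hμ hε hsmall hu hE

end Existence

/-- The phase diagram of the ground state problem on a graph with bottom of the spectrum `λ₁`, from
a bound of the sup norm by the spectral deficit and from compactness of nonvanishing almost
minimizers. -/
theorem groundState_phase_diagram {G : UnitMetricGraph} (hG : G.SpectralGap lambda1) {p : ℝ}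
    (hp2 : 2 < p) (hp6 : p < 6) {C : ℝ} (hC0 : 0 ≤ C)
    (hC : ∀ u, G.MemH1 u → ∀ e, ∀ x ∈ Icc (0 : ℝ) 1,
      u e x ^ 2 ≤ C * (G.kinetic u - lambda1 * G.mass u))
    (hcompact : ∀ μ c ε : ℝ, 0 < μ → 0 < c → 0 < ε →
      (∀ u, G.MemH1 u → G.mass u ≤ ε → G.level p μ / μ * G.mass u ≤ G.energy p u) →
      G.NonvanishingNear p μ (G.level p μ) c →
      ∃ v ∈ G.H1mass μ, G.energy p v ≤ G.level p μ) :
    (0 < lambda1 ∧ G.rayleighInf = lambda1) ∧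
    (∀ μ : ℝ, 0 ≤ μ → IsGLB (G.energy p '' G.H1mass μ) (G.level p μ)) ∧
    IsGreatest (linearMasses G p) (criticalMass G p) ∧
    (∀ μ : ℝ, 0 ≤ μ → μ ≤ criticalMass G p → G.level p μ = 1 / 2 * lambda1 * μ) ∧
    (∀ μ : ℝ, criticalMass G p < μ → G.level p μ < 1 / 2 * lambda1 * μ) ∧
    (∀ μ : ℝ, criticalMass G p < μ → ∃ u, G.IsGroundState p μ u) ∧
    (∀ μ : ℝ, 0 < μ → μ < criticalMass G p → ¬ ∃ u, G.IsGroundState p μ u) ∧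
    (4 ≤ p → 0 < criticalMass G p) ∧
    (4 < p → ∃ u, G.IsGroundState p (criticalMass G p) u) := by
  have hgr : IsGreatest (linearMasses G p) (criticalMass G p) := hG.isGreatest_sSup hp2 hp6
  set μs := criticalMass G p
  have hμs0 : 0 ≤ μs := hgr.1.1
  have hlin : G.level p μs = 1 / 2 * lambda1 * μs := hgr.1.2
  have hlt : ∀ μ : ℝ, μs < μ → G.level p μ < 1 / 2 * lambda1 * μ := fun μ hμ => by
    have hμ0 : 0 ≤ μ := hμs0.trans hμ.le
    exact (hG.level_le hp2 hp6 hμ0).lt_of_ne fun h => absurd (hgr.2 ⟨hμ0, h⟩) (not_le.2 hμ)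
  have hgs : ∀ {μ : ℝ}, (∃ v ∈ G.H1mass μ, G.energy p v ≤ G.level p μ) →
      ∃ u, G.IsGroundState p μ u := by
    rintro μ ⟨v, hv, hE⟩
    exact ⟨v, hv, hE.antisymm (level_le_energy hp2 hp6 hv)⟩
  have hpos : 4 ≤ p → 0 < μs := fun hp4 => by
    obtain ⟨μ, hμ, h⟩ := hG.exists_pos_level_eq hp2 hp6 hp4 hC0 hC
    exact hμ.trans_le (hgr.2 ⟨hμ.le, h⟩)
  refine ⟨⟨hG.pos, hG.rayleighInf_eq⟩, fun μ hμ => hG.isGLB_level hp2 hp6 hμ, hgr,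
    fun μ hμ hle => hG.level_eq_of_le hp2 hp6 hμ hle hlin, hlt, fun μ hμ => ?_,
    fun μ hμ hμs => hG.not_isGroundState hp2 hp6 hμ hμs hlin, hpos, fun hp4 => ?_⟩
  · have hμ0 : 0 < μ := hμs0.trans_lt hμ
    obtain ⟨c, hc, H⟩ := hG.exists_nonvanishingNear hp2 hμ0 (hlt μ hμ)
    obtain ⟨ε, hε, hsmall⟩ := hG.exists_small_mass hp2 hp6
      (show G.level p μ / μ < 1 / 2 * lambda1 from (div_lt_iff₀ hμ0).2 (hlt μ hμ))
    exact hgs (hcompact μ c ε hμ0 hc hε hsmall H)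
  · have hμ0 := hpos hp4.le
    obtain ⟨c, hc, H⟩ := hG.exists_nonvanishingNear_of_isGreatest hp4 hC0 hC hμ0 hlin hlt
    refine hgs (hcompact μs c μs hμ0 hc hμ0 (fun u hu hM => ?_) H)
    rw [hlin, mul_div_cancel_right₀ _ hμ0.ne']
    exact (hG.level_eq_iff hp2 hp6 (mass_nonneg u)).1
      (hG.level_eq_of_le hp2 hp6 (mass_nonneg u) hM hlin) u ⟨hu, rfl⟩

theorem theorem2 (G : UnitMetricGraph) (hG : G = binaryTree ∨ G = rootedBinaryTree)
    (p : ℝ) (hp2 : 2 < p) (hp6 : p < 6) :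
    -- `λ₁` is positive and the same for both trees
    (0 < lambda1 ∧ G.rayleighInf = lambda1) ∧
    -- the energy level is the (finite) infimum of the energy
    (∀ μ : ℝ, 0 ≤ μ → IsGLB (G.energy p '' G.H1mass μ) (G.level p μ)) ∧
    -- the critical mass is well defined as a maximum
    IsGreatest (linearMasses G p) (criticalMass G p) ∧
    (∀ μ : ℝ, 0 ≤ μ → μ ≤ criticalMass G p → G.level p μ = 1 / 2 * lambda1 * μ) ∧
    (∀ μ : ℝ, criticalMass G p < μ → G.level p μ < 1 / 2 * lambda1 * μ) ∧
    -- existence above, non-existence below the critical mass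
    (∀ μ : ℝ, criticalMass G p < μ → ∃ u, G.IsGroundState p μ u) ∧
    (∀ μ : ℝ, 0 < μ → μ < criticalMass G p → ¬ ∃ u, G.IsGroundState p μ u) ∧
    (4 ≤ p → 0 < criticalMass G p) ∧
    (4 < p → ∃ u, G.IsGroundState p (criticalMass G p) u) := by
  rcases hG with rfl | rfl
  · exact groundState_phase_diagram spectralGap_binaryTree hp2 hp6 deficit_constant_nonneg
      (fun u hu e x hx => sq_le_deficit_binaryTree hu e hx)
      fun μ c ε hμ hc _ _ H => exists_energy_le_binaryTree hp2 hp6 hμ hc le_rfl H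
  · exact groundState_phase_diagram spectralGap_rootedBinaryTree hp2 hp6
      (mul_nonneg (by norm_num) deficit_constant_nonneg)
      (fun u hu e x hx => sq_le_deficit_rootedBinaryTree hu e hx)
      fun μ c ε hμ hc hε hsmall H => exists_energy_le_rootedBinaryTree hp2 hp6 hμ hc hε hsmall H
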